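/- Let $h\in(1,2)$. Then there exist a uniformly continuous velocity field $W:[0,1]\times\mathbb{R}^2\to\mathbb{R}^2$ which is weakly divergence-free (that is, $\int_{\mathbb{R}^2} W(t,x)\cdot\nabla\varphi(x)\,dx=0$ for every $t\in[0,1]$ and every $\varphi\in C_c^\infty(\mathbb{R}^2)$) and a compact set $S\subset\mathbb{R}^2$ with Hausdorff dimension $\dim_H S=h$ such that the following hold. (i) $W$ admits a unique Lagrangian flow on $[0,1]\times\mathbb{R}^2$: there is exactly one map $X_W:[0,1]\times\mathbb{R}^2\to\mathbb{R}^2$ such that, for every $a\in\mathbb{R}^2$, $X_W(0,a)=a$ and $t\mapsto X_W(t,a)$ is differentiable on $[0,1]$ (one-sidedly at the end points) with $\partial_tX_W(t,a)=W(t,X_W(t,a))$ for all $t\in[0,1]$. (ii) $\dim_H X_W(t,S)=h$ for all $t\in[0,1)$, and $X_W(1,S)=\{(0,0)\}$. (iii) $S$ is the attractor of an inhomogeneous iterated function system built from rotations and scalings: with $\alpha=2^{-1/h}$, $\mathcal{R}(x_1,x_2)=(-x_2,x_1)$, $F_1(x)=(1,0)+\alpha\mathcal{R}x$, $F_2(x)=(-1,0)+\alpha\mathcal{R}x$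 and $I=[-1,1]\times\{0\}$, the set $S$ is the nonempty compact set satisfying $S=I\cup F_1(S)\cup F_2(S)$. -/

import Mathlib

open Set MeasureTheory
open scoped ContDiff

namespace FractalFlow

/-- The Euclidean plane `ℝ²`. -/
abbrev Plane : Type := EuclideanSpace ℝ (Fin 2)

/-- A vector field `v` on the plane is weakly divergence-free: `∫ v · ∇φ = 0` for every real test
function `φ ∈ C_c^∞(ℝ²)`. -/
def WeaklyDivFree (v : Plane → Plane) : Prop :=
  ∀ φ : Plane → ℝ, ContDiff ℝ ∞ φ → HasCompactSupport φ → ∫ x, fderiv ℝ φ x (v x) = 0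

/-- `X` is a trajectory map (Lagrangian flow) on `[0,T] × ℝ²` for the velocity `W`:
`X(0,a) = a` and `∂ₜ X(t,a) = W(t, X(t,a))` for all `a ∈ ℝ²` and all `t ∈ [0,T]`
(one-sided derivatives at the end points). -/
def IsTrajectoryMap (T : ℝ) (W X : ℝ → Plane → Plane) : Prop :=
  ∀ a : Plane, X 0 a = a ∧
    ∀ t ∈ Icc (0 : ℝ) T, HasDerivWithinAt (fun s => X s a) (W t (X t a)) (Icc 0 T) t

/-- `X` is the unique trajectory map of `W` on `[0,T] × ℝ²`; values at times outside `[0,T]`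
carry no meaning. -/
def IsUniqueTrajectoryMap (T : ℝ) (W X : ℝ → Plane → Plane) : Prop :=
  IsTrajectoryMap T W X ∧
    ∀ Y : ℝ → Plane → Plane, IsTrajectoryMap T W Y → ∀ t ∈ Icc (0 : ℝ) T, ∀ a, Y t a = X t a

/-- Counter-clockwise rotation by `π/2` about the origin, `(x₁, x₂) ↦ (-x₂, x₁)`. -/
noncomputable def rot (x : Plane) : Plane := !₂[-x 1, x 0]

/-- The two similarities `x ↦ (1,0) + α 𝓡 x` and `x ↦ (-1,0) + α 𝓡 x`. -/
noncomputable def ifsMap (α : ℝ) : Fin 2 → Plane → Plane :=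
  ![fun x => !₂[1, 0] + α • rot x, fun x => !₂[-1, 0] + α • rot x]

/-- `S` is an attractor of the inhomogeneous iterated function system with maps `F i` and
condensation set `C`: a nonempty compact set with `S = C ∪ ⋃ i, F i (S)`. (If the finitely many
`F i` are contractions and `C` is compact, there is at most one such set.) -/
def IsInhomogeneousAttractor {ι : Type} (F : ι → Plane → Plane) (C S : Set Plane) : Prop :=
  IsCompact S ∧ S.Nonempty ∧ S = C ∪ ⋃ i, F i '' S

/-- The line segment `[-1,1] × {0}`. -/
def unitSegment : Set Plane := segment ℝ !₂[-1, 0] !₂[1, 0]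

end FractalFlow

/-! Let `F i` be the two similarities, with translation parts `shift i`, and let `λ(t) = (1 - t)²`.
The field is `W(t,x) = λ'(t) U(x / λ(t))` for a bounded Lipschitz divergence-free `U` supported in a
rectangle `box α`. If `U` were the identity on the tree, the flow would be `a ↦ λ(t) a` there. It
suffices that `U` shares the equivariance of the identity, `U (F i x) = shift i + α 𝓡 U x` on the
box: if `X(t)` is a trajectory with `X(t) / λ(t)` in the box, then `λ(t) shift i + α 𝓡 X(t)` is
again one. Hence the starting points whose trajectories stay in `λ(t) • box α` form a closed set
invariant under both `F i`. It contains the segment by a one-dimensional comparison, so it contains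
the tree (`inv_smul_mem_box`), and letting `t → 1` collapses the tree to the origin.

The field `U` is the limit of iterating `V ↦ U₀ + ∑ i, α 𝓡 V (F i)⁻¹` (`exists_selfSimilar_field`).
Conjugation by `α 𝓡` does not increase the Lipschitz bound. The copies have disjoint supports, and
`U₀` is locally constant there, so the bound survives every step (`IsAdmissible.step`), while the
factor `α` gives uniform convergence.

Since `W` is Lipschitz in space away from `t = 1`, the flow is bi-Lipschitz before that time and
preserves dimension. Because `W` is bounded and continuous up to `t = 1`, trajectories also exist
and are unique on the closed interval. The dimension of the tree is `h` because `2 α ^ h = 1`: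
natural covers bound it above, and a Hölder map from the tips onto `[0,1]` bounds it below. -/

namespace FractalFlow

open Filter Topology
open scoped NNReal

/-! ### Flows that are Lipschitz before the final time -/

section ODE

variable {E : Type*} [NormedAddCommGroup E] [NormedSpace ℝ E]

/-- `x` solves `x' = W(t, x)` on `[0,T]`. -/
def IsSolution (T : ℝ) (W : ℝ → E → E) (x : ℝ → E) : Prop :=
  ∀ t ∈ Icc (0 : ℝ) T, HasDerivWithinAt x (W t (x t)) (Icc 0 T) t

theorem IsSolution.continuousOn {T : ℝ} {W : ℝ → E → E} {x : ℝ → E} (hx : IsSolution T W x) :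
    ContinuousOn x (Icc 0 T) := fun t ht => (hx t ht).continuousWithinAt

theorem IsSolution.mono {T T' : ℝ} {W : ℝ → E → E} {x : ℝ → E} (hx : IsSolution T W x)
    (h : T' ≤ T) : IsSolution T' W x := fun t ht =>
  (hx t ⟨ht.1, ht.2.trans h⟩).mono (Icc_subset_Icc_right h)

theorem IsSolution.hasDerivWithinAt_Ici {T : ℝ} {W : ℝ → E → E} {x : ℝ → E}
    (hx : IsSolution T W x) {t : ℝ} (ht : t ∈ Ico 0 T) :
    HasDerivWithinAt x (W t (x t)) (Ici t) t :=
  (hx t (Ico_subset_Icc_self ht)).mono_of_mem_nhdsWithin (Icc_mem_nhdsGE_of_mem ht)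

theorem IsSolution.eqOn {T : ℝ} {W : ℝ → E → E} {x y : ℝ → E} {K : ℝ≥0}
    (hK : ∀ t ∈ Icc 0 T, LipschitzWith K (W t)) (hx : IsSolution T W x) (hy : IsSolution T W y)
    (h : x 0 = y 0) : EqOn x y (Icc 0 T) :=
  ODE_solution_unique_of_mem_Icc_right (s := fun _ => univ)
    (fun t ht => (hK t (Ico_subset_Icc_self ht)).lipschitzOnWith) hx.continuousOn
    (fun _ ht => hx.hasDerivWithinAt_Ici ht) (fun _ _ => trivial) hy.continuousOn
    (fun _ ht => hy.hasDerivWithinAt_Ici ht) (fun _ _ => trivial) h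

theorem IsSolution.dist_le {T : ℝ} {W : ℝ → E → E} {x y : ℝ → E} {K : ℝ≥0}
    (hK : ∀ t ∈ Icc 0 T, LipschitzWith K (W t)) (hx : IsSolution T W x) (hy : IsSolution T W y)
    {t : ℝ} (ht : t ∈ Icc 0 T) : dist (x t) (y t) ≤ dist (x 0) (y 0) * Real.exp (K * t) := by
  have := dist_le_of_trajectories_ODE_of_mem (s := fun _ => univ)
    (fun t ht => (hK t (Ico_subset_Icc_self ht)).lipschitzOnWith) hx.continuousOn
    (fun _ ht => hx.hasDerivWithinAt_Ici ht) (fun _ _ => trivial) hy.continuousOn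
    (fun _ ht => hy.hasDerivWithinAt_Ici ht) (fun _ _ => trivial) le_rfl t ht
  simpa using this

/-- Reversing time turns solutions into solutions. -/
theorem IsSolution.reverse {T : ℝ} {W : ℝ → E → E} {x : ℝ → E} (hx : IsSolution T W x) :
    IsSolution T (fun s y => -W (T - s) y) (fun s => x (T - s)) := by
  intro s hs
  have hs' : T - s ∈ Icc 0 T := ⟨by linarith [hs.2], by linarith [hs.1]⟩
  have h1 : HasDerivWithinAt (fun s : ℝ => T - s) (-1) (Icc 0 T) s := by
    simpa using ((hasDerivAt_id s).const_sub T).hasDerivWithinAt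
  have := (hx (T - s) hs').scomp s h1
    (fun r hr => ⟨by linarith [hr.2], by linarith [hr.1]⟩)
  simpa [Function.comp_def] using this

theorem IsSolution.dist_zero_le {T : ℝ} {W : ℝ → E → E} {x y : ℝ → E} {K : ℝ≥0}
    (hK : ∀ t ∈ Icc 0 T, LipschitzWith K (W t)) (hx : IsSolution T W x) (hy : IsSolution T W y)
    (hT : 0 ≤ T) : dist (x 0) (y 0) ≤ dist (x T) (y T) * Real.exp (K * T) := by
  have := IsSolution.dist_le (K := K) (fun t ht => (hK (T - t) ⟨by linarith [ht.2],
    by linarith [ht.1]⟩).neg) hx.reverse hy.reverse (right_mem_Icc.2 hT)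
  simpa using this

/-- Velocity fields that are bounded and continuous up to time `1`, and Lipschitz in space,
uniformly on each `[0,T]` with `T < 1`. -/
structure IsTamed (W : ℝ → E → E) : Prop where
  continuous : Continuous (fun p : ℝ × E => W p.1 p.2)
  bounded : ∃ M : ℝ≥0, ∀ t ∈ Icc (0 : ℝ) 1, ∀ x, ‖W t x‖ ≤ M
  lipschitz : ∀ T < 1, ∃ K : ℝ≥0, ∀ t ∈ Icc 0 T, LipschitzWith K (W t)

theorem IsTamed.eqOn {W : ℝ → E → E} (hW : IsTamed W) {x y : ℝ → E}
    (hx : IsSolution 1 W x) (hy : IsSolution 1 W y) (h : x 0 = y 0) : EqOn x y (Icc 0 1) := by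
  have h1 : EqOn x y (Ico 0 1) := fun t ht => by
    obtain ⟨K, hK⟩ := hW.lipschitz t ht.2
    exact (hx.mono ht.2.le).eqOn hK (hy.mono ht.2.le) h (right_mem_Icc.2 ht.1)
  refine h1.of_subset_closure hx.continuousOn hy.continuousOn Ico_subset_Icc_self ?_
  rw [closure_Ico zero_ne_one]

variable [CompleteSpace E]

theorem IsTamed.exists_isSolution_lt {W : ℝ → E → E} (hW : IsTamed W) {T : ℝ} (h0 : 0 ≤ T)
    (h1 : T < 1) (a : E) : ∃ x, x 0 = a ∧ IsSolution T W x := by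
  obtain ⟨M, hM⟩ := hW.bounded
  obtain ⟨K, hK⟩ := hW.lipschitz T h1
  have : IsPicardLindelof W (tmin := 0) (tmax := T) ⟨0, left_mem_Icc.2 h0⟩ a M 0 M K :=
    { lipschitzOnWith := fun t ht => (hK t ht).lipschitzOnWith
      continuousOn := fun x _ =>
        (hW.continuous.comp (Continuous.prodMk_left x)).continuousOn
      norm_le := fun t ht x _ => hM t ⟨ht.1, ht.2.trans h1.le⟩ x
      -- The ball of radius `M` cannot be left at speed at most `M` in time less than one.
      mul_max_le := by
        simp only [sub_zero, NNReal.coe_zero, sub_self]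
        rw [max_eq_left h0]
        nlinarith [M.2] }
  exact this.exists_eq_forall_mem_Icc_hasDerivWithinAt (by simp)

/-- Solutions on `[0,T]`, `T < 1`, glue by uniqueness. Bounded velocity makes the glued curve
Lipschitz, so it has a limit at time `1`; continuity of `W` then supplies the one-sided derivative
there. -/
theorem IsTamed.exists_isSolution {W : ℝ → E → E} (hW : IsTamed W) (a : E) :
    ∃ x, x 0 = a ∧ IsSolution 1 W x := by
  obtain ⟨M, hM⟩ := hW.bounded
  have hex : ∀ T : ℝ, ∃ x : ℝ → E, 0 ≤ T → T < 1 → x 0 = a ∧ IsSolution T W x := fun T => by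
    by_cases hT : 0 ≤ T ∧ T < 1
    · obtain ⟨x, hx⟩ := hW.exists_isSolution_lt hT.1 hT.2 a
      exact ⟨x, fun _ _ => hx⟩
    · exact ⟨0, fun h h' => (hT ⟨h, h'⟩).elim⟩
  choose y hy using hex
  have hagree : ∀ T < 1, ∀ s ∈ Icc 0 T, y s s = y T s := fun T hT s hs => by
    obtain ⟨K, hK⟩ := hW.lipschitz s (hs.2.trans_lt hT)
    have h1 := hy s hs.1 (hs.2.trans_lt hT)
    have h2 := hy T (hs.1.trans hs.2) hT
    exact h1.2.eqOn hK (h2.2.mono hs.2) (h1.1.trans h2.1.symm) (right_mem_Icc.2 hs.1)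
  -- The diagonal selection: each time is read off the solution chosen for exactly that time, and
  -- `hagree` makes the choices compatible.
  set z : ℝ → E := fun t => y t t with hz
  have hzd : ∀ t ∈ Ico (0 : ℝ) 1, HasDerivWithinAt z (W t (z t)) (Ico 0 1) t := fun t ht => by
    obtain ⟨T, hT1, hT2⟩ := exists_between ht.2
    have h2 := (hy T (ht.1.trans hT1.le) hT2).2 t ⟨ht.1, hT1.le⟩
    have h3 : HasDerivWithinAt z (W t (z t)) (Icc 0 T) t := by
      rw [show z t = y T t from hagree T hT2 t ⟨ht.1, hT1.le⟩]
      exact h2.congr (fun s hs => hagree T hT2 s hs) (hagree T hT2 t ⟨ht.1, hT1.le⟩)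
    refine h3.mono_of_mem_nhdsWithin ?_
    filter_upwards [self_mem_nhdsWithin, mem_nhdsWithin_of_mem_nhds (Iio_mem_nhds hT1)] with s hs hs'
    exact ⟨hs.1, (mem_Iio.1 hs').le⟩
  have hlip : LipschitzOnWith M z (Ico 0 1) :=
    (convex_Ico 0 1).lipschitzOnWith_of_nnnorm_hasDerivWithin_le hzd
      (fun t ht => hM t (Ico_subset_Icc_self ht) _)
  obtain ⟨l, hl⟩ : ∃ l, Tendsto z (𝓝[Ico 0 1] 1) (𝓝 l) := by
    have : (𝓝[Ico 0 1] (1 : ℝ)).NeBot := by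
      rw [← mem_closure_iff_nhdsWithin_neBot, closure_Ico zero_ne_one]; simp
    have hc : Cauchy (𝓝[Ico 0 1] (1 : ℝ)) := cauchy_nhds.mono nhdsWithin_le_nhds
    exact cauchy_map_iff_exists_tendsto.1 (hc.map_of_le hlip.uniformContinuousOn inf_le_right)
  have hnhds : 𝓝[Ico 0 1] (1 : ℝ) = 𝓝[<] 1 := nhdsWithin_Ico_eq_nhdsLT zero_lt_one
  set x : ℝ → E := Function.update z 1 l with hx
  have hxz : EqOn x z (Ico 0 1) := fun t ht => Function.update_of_ne ht.2.ne _ _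
  have hxd : ∀ t ∈ Ico (0 : ℝ) 1, HasDerivWithinAt x (W t (x t)) (Ico 0 1) t := fun t ht => by
    rw [hxz ht]; exact (hzd t ht).congr hxz (hxz ht)
  have hxl : Tendsto x (𝓝[<] 1) (𝓝 (x 1)) := by
    rw [show x 1 = l by simp [hx], ← hnhds]
    exact hl.congr' (by filter_upwards [self_mem_nhdsWithin] with t ht using (hxz ht).symm)
  refine ⟨x, ?_, fun t ht => ?_⟩
  · rw [hxz ⟨le_rfl, zero_lt_one⟩]; exact (hy 0 le_rfl zero_lt_one).1
  rcases eq_or_lt_of_le ht.2 with rfl | h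
  · refine (hasDerivWithinAt_Iic_of_tendsto_deriv (s := Ico 0 1)
      (fun s hs => (hxd s hs).differentiableWithinAt) ?_ ?_ ?_).mono Icc_subset_Iic_self
    · rw [ContinuousWithinAt, hnhds]; exact hxl
    · rw [← hnhds]; exact self_mem_nhdsWithin
    · have : Tendsto (fun s => W s (x s)) (𝓝[<] 1) (𝓝 (W 1 (x 1))) :=
        (hW.continuous.tendsto (1, x 1)).comp
          ((tendsto_nhdsWithin_of_tendsto_nhds tendsto_id).prodMk_nhds hxl)
      refine this.congr' ?_
      filter_upwards [Ioo_mem_nhdsLT zero_lt_one] with s hs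
      exact ((hxd s (Ioo_subset_Ico_self hs)).hasDerivAt (Ico_mem_nhds hs.1 hs.2)).deriv.symm
  · refine (hxd t ⟨ht.1, h⟩).mono_of_mem_nhdsWithin ?_
    filter_upwards [self_mem_nhdsWithin, mem_nhdsWithin_of_mem_nhds (Iio_mem_nhds h)] with s hs hs'
    exact ⟨hs.1, hs'⟩

end ODE

theorem IsTamed.exists_isUniqueTrajectoryMap {W : ℝ → Plane → Plane} (hW : IsTamed W) :
    ∃ X, IsUniqueTrajectoryMap 1 W X := by
  choose X hX using hW.exists_isSolution
  exact ⟨fun t a => X a t, fun a => hX a, fun Y hY t ht a =>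
    hW.eqOn (hY a).2 (hX a).2 ((hY a).1.trans (hX a).1.symm) ht⟩

/-- Grönwall forwards and backwards in time makes `X t` bi-Lipschitz. -/
theorem IsTamed.dimH_image {W X : ℝ → Plane → Plane} (hW : IsTamed W)
    (hX : IsTrajectoryMap 1 W X) {t : ℝ} (ht : t ∈ Ico (0 : ℝ) 1) (S : Set Plane) :
    dimH (X t '' S) = dimH S := by
  obtain ⟨K, hK⟩ := hW.lipschitz t ht.2
  have hs : ∀ a, IsSolution t W (fun s => X s a) := fun a =>
    IsSolution.mono (T := 1) (hX a).2 ht.2.le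
  have h1 : LipschitzWith (Real.toNNReal (Real.exp (K * t))) (X t) :=
    LipschitzWith.of_dist_le_mul fun a b => by
      have := (hs a).dist_le hK (hs b) (right_mem_Icc.2 ht.1)
      rw [(hX a).1, (hX b).1] at this
      rw [Real.coe_toNNReal _ (Real.exp_pos _).le, mul_comm]; exact this
  have h2 : AntilipschitzWith (Real.toNNReal (Real.exp (K * t))) (X t) :=
    AntilipschitzWith.of_le_mul_dist fun a b => by
      have := (hs a).dist_zero_le hK (hs b) ht.1
      rw [(hX a).1, (hX b).1] at this
      rw [Real.coe_toNNReal _ (Real.exp_pos _).le, mul_comm]; exact this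
  exact le_antisymm (h1.dimH_image_le S) (h2.le_dimH_image S)

end FractalFlow

/-! ### The inhomogeneous attractor -/

namespace FractalFlow

open Filter Topology
open scoped NNReal ENNReal

/-- The rotation `rot` as a linear isometric equivalence. -/
noncomputable def rotEquiv : Plane ≃ₗᵢ[ℝ] Plane where
  toFun := rot
  invFun x := !₂[x 1, -x 0]
  map_add' x y := by ext i; fin_cases i <;> simp [rot]; ring
  map_smul' c x := by ext i; fin_cases i <;> simp [rot]
  left_inv x := by ext i; fin_cases i <;> simp [rot]
  right_inv x := by ext i; fin_cases i <;> simp [rot]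
  norm_map' x := by simp [rot, EuclideanSpace.norm_eq, Fin.sum_univ_two, add_comm]

@[simp] theorem rotEquiv_apply (x : Plane) : rotEquiv x = rot x := rfl

/-- The translation parts `(1,0)` and `(-1,0)` of the two similarities. -/
noncomputable def shift : Fin 2 → Plane := ![!₂[1, 0], !₂[-1, 0]]

theorem ifsMap_apply (α : ℝ) (i : Fin 2) (x : Plane) :
    ifsMap α i x = shift i + α • rotEquiv x := by
  fin_cases i <;> simp [ifsMap, shift]

@[simp] theorem norm_shift (i : Fin 2) : ‖shift i‖ = 1 := by
  fin_cases i <;> simp [shift, EuclideanSpace.norm_eq, Fin.sum_univ_two]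

theorem dist_ifsMap {α : ℝ} (hα : 0 < α) (i : Fin 2) (x y : Plane) :
    dist (ifsMap α i x) (ifsMap α i y) = α * dist x y := by
  rw [ifsMap_apply, ifsMap_apply, dist_add_left, dist_smul₀, rotEquiv.dist_map, Real.norm_eq_abs,
    abs_of_pos hα]

theorem lipschitzWith_ifsMap {α : ℝ} (hα : 0 < α) (i : Fin 2) :
    LipschitzWith (Real.toNNReal α) (ifsMap α i) :=
  LipschitzWith.of_dist_le_mul fun x y => by
    rw [dist_ifsMap hα, Real.coe_toNNReal _ hα.le]

/-- The segments of the tree of generation `n`. -/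
noncomputable def generation (α : ℝ) : ℕ → Set Plane
  | 0 => unitSegment
  | n + 1 => ⋃ i, ifsMap α i '' generation α n

/-- The union of all segments of the tree. -/
noncomputable def branches (α : ℝ) : Set Plane := ⋃ n, generation α n

/-- The attractor: the closure of the union of all segments. -/
noncomputable def tree (α : ℝ) : Set Plane := closure (branches α)

theorem branches_eq (α : ℝ) : branches α = unitSegment ∪ ⋃ i, ifsMap α i '' branches α := by
  have h : ∀ i, ifsMap α i '' branches α = ⋃ n, ifsMap α i '' generation α n := fun i => by
    rw [branches, image_iUnion]
  simp_rw [h]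
  rw [iUnion_comm, branches, ← union_iUnion_nat_succ]
  rfl

theorem branches_subset {α : ℝ} {G : Set Plane} (hI : unitSegment ⊆ G)
    (hF : ∀ i, MapsTo (ifsMap α i) G G) : branches α ⊆ G := by
  refine iUnion_subset fun n => ?_
  induction n with
  | zero => exact hI
  | succ n ih => exact iUnion_subset fun i => ((hF i).mono_left ih).image_subset

/-- The induction principle for the tree; it later gives the bounding ball, the bounding rectangle
and the confinement of trajectories. -/
theorem tree_subset {α : ℝ} {G : Set Plane} (hG : IsClosed G) (hI : unitSegment ⊆ G)
    (hF : ∀ i, MapsTo (ifsMap α i) G G) : tree α ⊆ G :=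
  closure_minimal (branches_subset hI hF) hG

theorem unitSegment_eq : unitSegment = (fun s : ℝ => (!₂[s, 0] : Plane)) '' Icc (-1) 1 := by
  have h : (fun s : ℝ => (!₂[s, 0] : Plane)) =
      (LinearMap.toSpanSingleton ℝ Plane !₂[1, 0]).toAffineMap := by
    ext s i; fin_cases i <;> simp
  rw [h, ← segment_eq_Icc (by norm_num), image_segment, unitSegment]
  congr 1 <;> ext i <;> fin_cases i <;> simp

theorem tree_subset_closedBall {α : ℝ} (hα : 0 < α) (hα1 : α < 1) :
    tree α ⊆ Metric.closedBall 0 (1 / (1 - α)) := by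
  have h1 : 0 < 1 - α := by linarith
  refine tree_subset Metric.isClosed_closedBall ?_ fun i x hx => ?_
  · rw [unitSegment_eq]
    rintro _ ⟨s, hs, rfl⟩
    have : ‖(!₂[s, 0] : Plane)‖ ≤ 1 := by
      simpa [EuclideanSpace.norm_eq, Fin.sum_univ_two, Real.sqrt_sq_eq_abs, abs_le] using hs
    refine mem_closedBall_zero_iff.2 (this.trans ?_)
    rw [le_div_iff₀ h1]; linarith
  · rw [mem_closedBall_zero_iff] at hx ⊢
    rw [ifsMap_apply]
    refine (norm_add_le _ _).trans ?_
    rw [norm_shift, norm_smul, LinearIsometryEquiv.norm_map, Real.norm_eq_abs, abs_of_pos hα]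
    rw [le_div_iff₀ h1] at hx ⊢
    nlinarith

theorem isCompact_tree {α : ℝ} (hα : 0 < α) (hα1 : α < 1) : IsCompact (tree α) :=
  (isCompact_closedBall _ _).of_isClosed_subset isClosed_closure (tree_subset_closedBall hα hα1)

theorem tree_eq {α : ℝ} (hα : 0 < α) (hα1 : α < 1) :
    tree α = unitSegment ∪ ⋃ i, ifsMap α i '' tree α := by
  have hI : IsClosed unitSegment := by
    rw [unitSegment_eq]
    refine (isCompact_Icc.image ?_).isClosed
    fun_prop
  conv_lhs => rw [tree, branches_eq, closure_union, hI.closure_eq,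
    (locallyFinite_of_finite _).closure_iUnion]
  congr 2
  ext1 i
  rw [tree, image_closure_of_isCompact (isCompact_tree hα hα1)
    (lipschitzWith_ifsMap hα i).continuous.continuousOn]

theorem zero_mem_tree (α : ℝ) : (0 : Plane) ∈ tree α := by
  refine subset_closure (mem_iUnion.2 ⟨0, ?_⟩)
  rw [generation, unitSegment_eq]
  exact ⟨0, by norm_num, by ext i; fin_cases i <;> simp⟩

theorem isInhomogeneousAttractor_tree {α : ℝ} (hα : 0 < α) (hα1 : α < 1) :
    IsInhomogeneousAttractor (ifsMap α) unitSegment (tree α) :=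
  ⟨isCompact_tree hα hα1, ⟨0, zero_mem_tree α⟩, tree_eq hα hα1⟩

theorem mapsTo_ifsMap_tree {α : ℝ} (hα : 0 < α) (hα1 : α < 1) (i : Fin 2) :
    MapsTo (ifsMap α i) (tree α) (tree α) := fun x hx => by
  rw [tree_eq hα hα1]
  exact Or.inr (mem_iUnion.2 ⟨i, mem_image_of_mem _ hx⟩)

/-! ### Upper bound for the dimension -/

theorem dimH_branches_le {α : ℝ} (hα : 0 < α) : dimH (branches α) ≤ 1 := by
  rw [branches, dimH_iUnion]
  refine iSup_le fun n => ?_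
  induction n with
  | zero =>
    rw [generation, unitSegment_eq]
    have hl : LipschitzWith 1 (fun s : ℝ => (!₂[s, 0] : Plane)) :=
      LipschitzWith.of_dist_le_mul fun s t => by
        simp [EuclideanSpace.dist_eq, Fin.sum_univ_two, Real.sqrt_sq dist_nonneg]
    refine (hl.dimH_image_le _).trans ((dimH_mono (subset_univ _)).trans ?_)
    simp [Real.dimH_univ]
  | succ n ih =>
    rw [generation, dimH_iUnion]
    exact iSup_le fun i => ((lipschitzWith_ifsMap hα i).dimH_image_le _).trans ih

/-- Unfolding the self-similarity `n` times leaves, besides segments, one copy of the tree scaled by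
`α ^ n` for each word of length `n`. -/
theorem exists_cover_tree {α : ℝ} (hα : 0 < α) (hα1 : α < 1) (n : ℕ) :
    ∃ t : (Fin n → Fin 2) → Set Plane,
      (∀ w, Metric.ediam (t w) ≤ ENNReal.ofReal α ^ n * Metric.ediam (tree α)) ∧
        tree α ⊆ branches α ∪ ⋃ w, t w := by
  induction n with
  | zero =>
    exact ⟨fun _ => tree α, fun _ => by simp, fun x hx => Or.inr (mem_iUnion.2 ⟨0, hx⟩)⟩
  | succ n ih =>
    obtain ⟨t, ht, hc⟩ := ih
    refine ⟨fun w => ifsMap α (w 0) '' t (Fin.tail w), fun w => ?_, fun x hx => ?_⟩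
    · refine ((lipschitzWith_ifsMap hα _).ediam_image_le _).trans ?_
      rw [pow_succ', mul_assoc]
      exact mul_le_mul_right (ht _) _
    · rw [tree_eq hα hα1] at hx
      rcases hx with hx | hx
      · rw [branches_eq]; exact Or.inl (Or.inl hx)
      · obtain ⟨i, y, hy, rfl⟩ := mem_iUnion.1 hx
        rcases hc hy with h | h
        · rw [branches_eq]; exact Or.inl (Or.inr (mem_iUnion.2 ⟨i, mem_image_of_mem _ h⟩))
        · obtain ⟨w, hw⟩ := mem_iUnion.1 h
          exact Or.inr (mem_iUnion.2 ⟨Fin.cons i w, by simpa using mem_image_of_mem _ hw⟩)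

/-- The segments have dimension at most `1 ≤ h`. What remains is covered by `2 ^ n` sets of diameter
at most `α ^ n d`, whose `h`-sum is bounded by `(2 α ^ h) ^ n d ^ h = d ^ h`, so its `h`-measure is
finite. -/
theorem dimH_tree_le {α h : ℝ} (hα : 0 < α) (hα1 : α < 1) (h1 : 1 ≤ h) (hh : 2 * α ^ h = 1) :
    dimH (tree α) ≤ ENNReal.ofReal h := by
  have h0 : 0 ≤ h := by linarith
  set d := Metric.ediam (tree α) with hd
  have hdfin : d ≠ ⊤ := (isCompact_tree hα hα1).isBounded.ediam_ne_top
  have hα' : ENNReal.ofReal α < 1 := by simpa using hα1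
  choose t ht hc using exists_cover_tree hα hα1
  have hμ : μH[h] (tree α \ branches α) ≤ d ^ h := by
    refine (Measure.hausdorffMeasure_le_liminf_sum h _ (l := atTop)
      (fun n : ℕ => ENNReal.ofReal α ^ n * d) ?_ t (.of_forall ht)
      (.of_forall fun n => sdiff_subset_iff.2 (hc n))).trans ?_
    · simpa using ENNReal.Tendsto.mul_const
        (ENNReal.tendsto_pow_atTop_nhds_zero_of_lt_one hα') (Or.inr hdfin)
    · refine (liminf_le_liminf (v := fun _ => d ^ h) (.of_forall fun n => ?_)).trans
        (by simp [liminf_const])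
      calc ∑ w, Metric.ediam (t n w) ^ h ≤ ∑ _w : Fin n → Fin 2, (ENNReal.ofReal α ^ n * d) ^ h :=
            Finset.sum_le_sum fun w _ => ENNReal.rpow_le_rpow (ht n w) h0
        _ = (2 * ENNReal.ofReal α ^ h) ^ n * d ^ h := by
            rw [Finset.sum_const, Finset.card_univ, Fintype.card_fun, Fintype.card_fin,
              Fintype.card_fin, nsmul_eq_mul, ENNReal.mul_rpow_of_nonneg _ _ h0, mul_pow,
              ← ENNReal.rpow_natCast, ← ENNReal.rpow_natCast, ← ENNReal.rpow_mul,
              ← ENNReal.rpow_natCast, ← ENNReal.rpow_mul, mul_comm (n : ℝ) h]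
            push_cast
            rw [mul_assoc, ENNReal.rpow_natCast]
        _ = d ^ h := by
            rw [ENNReal.ofReal_rpow_of_pos hα, show (2 : ℝ≥0∞) = ENNReal.ofReal 2 by simp,
              ← ENNReal.ofReal_mul zero_le_two, hh]
            simp
  have h2 : dimH (tree α \ branches α) ≤ ENNReal.ofReal h := by
    refine dimH_le_of_hausdorffMeasure_ne_top (d := h.toNNReal) ?_
    rw [Real.coe_toNNReal _ h0]
    exact ne_top_of_le_ne_top (ENNReal.rpow_ne_top_of_nonneg h0 hdfin) hμ
  calc dimH (tree α) ≤ dimH (branches α ∪ tree α \ branches α) :=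
        dimH_mono (by rw [union_sdiff_self]; exact subset_union_right)
    _ ≤ ENNReal.ofReal h := by
        rw [dimH_union]
        refine max_le ((dimH_branches_le hα).trans ?_) h2
        simpa using h1

/-! ### The separating rectangle -/

/-- A closed rectangle that contains its images under both similarities. -/
def box (α : ℝ) : Set Plane := {x | |x 0| ≤ 2 ∧ α * |x 1| ≤ α ^ 2 + 1 / 2}

theorem isClosed_box (α : ℝ) : IsClosed (box α) :=
  IsClosed.inter (s₁ := {x : Plane | |x 0| ≤ 2}) (s₂ := {x : Plane | α * |x 1| ≤ α ^ 2 + 1 / 2})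
    (isClosed_le (by fun_prop) (by fun_prop)) (isClosed_le (by fun_prop) (by fun_prop))

theorem ifsMap_zero_apply_zero (α : ℝ) (x : Plane) : ifsMap α 0 x 0 = 1 - α * x 1 := by
  simp [ifsMap, rot]; ring

theorem ifsMap_one_apply_zero (α : ℝ) (x : Plane) : ifsMap α 1 x 0 = -1 - α * x 1 := by
  simp [ifsMap, rot]; ring

theorem ifsMap_apply_one (α : ℝ) (i : Fin 2) (x : Plane) : ifsMap α i x 1 = α * x 0 := by
  fin_cases i <;> simp [ifsMap, rot]

/-- Writing `b` for the bound on `α |x 1|`, invariance needs `2 α ^ 2 ≤ b ≤ 1`; the value `α ^ 2 + 1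
/ 2` is the midpoint, which leaves room on both sides. -/
theorem mapsTo_ifsMap_box {α : ℝ} (hα : 0 < α) (hq : 2 * α ^ 2 < 1) (i : Fin 2) :
    MapsTo (ifsMap α i) (box α) (box α) := by
  rintro x ⟨h0, h1⟩
  rw [abs_le] at h0
  have h2 : |α * x 1| ≤ α ^ 2 + 1 / 2 := by rwa [abs_mul, abs_of_pos hα]
  rw [abs_le] at h2
  refine ⟨?_, ?_⟩
  · rw [abs_le]
    fin_cases i
    · show -2 ≤ ifsMap α 0 x 0 ∧ ifsMap α 0 x 0 ≤ 2
      rw [ifsMap_zero_apply_zero]; constructor <;> linarith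
    · show -2 ≤ ifsMap α 1 x 0 ∧ ifsMap α 1 x 0 ≤ 2
      rw [ifsMap_one_apply_zero]; constructor <;> linarith
  · rw [ifsMap_apply_one, abs_mul, abs_of_pos hα]
    have := abs_le.2 h0
    nlinarith [sq_nonneg α]

theorem unitSegment_subset_box {α : ℝ} : unitSegment ⊆ box α := by
  rw [unitSegment_eq]
  rintro _ ⟨s, hs, rfl⟩
  have := abs_le.2 hs
  refine ⟨?_, ?_⟩
  · show |s| ≤ 2
    linarith
  · show α * |0| ≤ _
    rw [abs_zero, mul_zero]; positivity

theorem tree_subset_box {α : ℝ} (hα : 0 < α) (hq : 2 * α ^ 2 < 1) : tree α ⊆ box α :=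
  tree_subset (isClosed_box α) unitSegment_subset_box (mapsTo_ifsMap_box hα hq)

/-- The first coordinates of the two images lie within `α ^ 2 + 1 / 2 < 1` of `1` and of `-1`
respectively. -/
theorem le_dist_ifsMap {α : ℝ} (hα : 0 < α) {i j : Fin 2} (hij : i ≠ j) {x y : Plane}
    (hx : x ∈ box α) (hy : y ∈ box α) :
    1 - 2 * α ^ 2 ≤ dist (ifsMap α i x) (ifsMap α j y) := by
  have key : ∀ x ∈ box α, ∀ y ∈ box α, 1 - 2 * α ^ 2 ≤ dist (ifsMap α 0 x) (ifsMap α 1 y) := by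
    rintro x ⟨-, hx⟩ y ⟨-, hy⟩
    rw [← abs_of_pos hα, ← abs_mul, abs_of_pos hα, abs_le] at hx hy
    have h : |(ifsMap α 0 x - ifsMap α 1 y) 0| ≤ ‖ifsMap α 0 x - ifsMap α 1 y‖ :=
      PiLp.norm_apply_le (ifsMap α 0 x - ifsMap α 1 y) (0 : Fin 2)
    rw [PiLp.sub_apply, ifsMap_zero_apply_zero, ifsMap_one_apply_zero] at h
    rw [dist_eq_norm]
    linarith [le_abs_self (1 - α * x 1 - (-1 - α * y 1))]
  fin_cases i <;> fin_cases j
  · exact absurd rfl hij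
  · exact key x hx y hy
  · rw [dist_comm]; exact key y hy x hx
  · exact absurd rfl hij

/-! ### Symbolic coding of the tips and the lower bound -/

/-- The linear part of the similarities as a continuous linear map. -/
noncomputable def linPart (α : ℝ) : Plane →L[ℝ] Plane := α • (rotEquiv : Plane →L[ℝ] Plane)

theorem linPart_apply (α : ℝ) (x : Plane) : linPart α x = α • rotEquiv x := rfl

theorem norm_linPart_pow {α : ℝ} (hα : 0 < α) (n : ℕ) (x : Plane) :
    ‖(linPart α ^ n) x‖ = α ^ n * ‖x‖ := by
  induction n with
  | zero => simp
  | succ n ih =>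
    rw [pow_succ', mul_apply_eq_comp, linPart_apply, norm_smul,
      LinearIsometryEquiv.norm_map, ih, Real.norm_eq_abs, abs_of_pos hα, pow_succ', mul_assoc]

/-- The tip of the tree with a given itinerary. -/
noncomputable def tip (α : ℝ) (σ : ℕ → Fin 2) : Plane := ∑' n, (linPart α ^ n) (shift (σ n))

theorem norm_linPart_pow_shift {α : ℝ} (hα : 0 < α) (n : ℕ) (i : Fin 2) :
    ‖(linPart α ^ n) (shift i)‖ = α ^ n := by
  rw [norm_linPart_pow hα, norm_shift, mul_one]

theorem tip_eq {α : ℝ} (hα : 0 < α) (hα1 : α < 1) (σ : ℕ → Fin 2) :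
    tip α σ = ifsMap α (σ 0) (tip α fun n => σ (n + 1)) := by
  have hs : ∀ σ : ℕ → Fin 2, Summable fun n => (linPart α ^ n) (shift (σ n)) := fun σ =>
    Summable.of_norm_bounded (summable_geometric_of_lt_one hα.le hα1)
      fun n => (norm_linPart_pow_shift hα n _).le
  rw [tip, (hs σ).tsum_eq_zero_add, ifsMap_apply, ← linPart_apply, tip,
    ContinuousLinearMap.map_tsum _ (hs _)]
  simp [pow_succ']

theorem norm_tip_le {α : ℝ} (hα : 0 < α) (hα1 : α < 1) (σ : ℕ → Fin 2) :
    ‖tip α σ‖ ≤ (1 - α)⁻¹ :=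
  tsum_of_norm_bounded (hasSum_geometric_of_lt_one hα.le hα1)
    fun n => (norm_linPart_pow_shift hα n _).le

theorem tip_mem_tree {α : ℝ} (hα : 0 < α) (hα1 : α < 1) (σ : ℕ → Fin 2) : tip α σ ∈ tree α := by
  have key : ∀ (n : ℕ) (σ : ℕ → Fin 2), ∃ s ∈ tree α, dist (tip α σ) s ≤ α ^ n * (1 - α)⁻¹ := by
    intro n
    induction n with
    | zero =>
      exact fun σ => ⟨0, zero_mem_tree α, by simpa using norm_tip_le hα hα1 σ⟩
    | succ n ih =>
      intro σ
      obtain ⟨s, hs, hd⟩ := ih fun n => σ (n + 1)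
      refine ⟨_, mapsTo_ifsMap_tree hα hα1 (σ 0) hs, ?_⟩
      rw [tip_eq hα hα1, dist_ifsMap hα, pow_succ', mul_assoc]
      gcongr
  rw [← (isCompact_tree hα hα1).isClosed.closure_eq, Metric.mem_closure_iff]
  intro ε hε
  have : Tendsto (fun n : ℕ => α ^ n * (1 - α)⁻¹) atTop (𝓝 (0 * (1 - α)⁻¹)) :=
    (tendsto_pow_atTop_nhds_zero_of_lt_one hα.le hα1).mul_const _
  rw [zero_mul] at this
  obtain ⟨n, hn⟩ := (this.eventually (gt_mem_nhds hε)).exists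
  obtain ⟨s, hs, hd⟩ := key n σ
  exact ⟨s, hs, hd.trans_lt hn⟩

theorem dist_tip {α : ℝ} (hα : 0 < α) (hα1 : α < 1) (n : ℕ) :
    ∀ σ σ' : ℕ → Fin 2, (∀ i < n, σ i = σ' i) →
      dist (tip α σ) (tip α σ') =
        α ^ n * dist (tip α fun k => σ (k + n)) (tip α fun k => σ' (k + n)) := by
  induction n with
  | zero => intro σ σ' _; simp
  | succ n ih =>
    intro σ σ' h
    rw [tip_eq hα hα1 σ, tip_eq hα hα1 σ', h 0 n.succ_pos, dist_ifsMap hα,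
      ih _ _ fun i hi => h (i + 1) (by omega), pow_succ', mul_assoc]
    simp only [add_assoc]

/-- Reading an itinerary as a binary expansion is Hölder continuous of exponent `h` with respect to
the position of the tip. -/
theorem abs_ofDigits_sub_le {α h : ℝ} (hα : 0 < α) (hq : 2 * α ^ 2 < 1) (h0 : 0 < h)
    (hh : 2 * α ^ h = 1) (σ σ' : ℕ → Fin 2) :
    |Real.ofDigits σ - Real.ofDigits σ'| ≤
      ((1 - 2 * α ^ 2)⁻¹) ^ h * dist (tip α σ) (tip α σ') ^ h := by
  have hα1 : α < 1 := by nlinarith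
  have hc : 0 < 1 - 2 * α ^ 2 := by linarith
  by_cases hne : σ = σ'
  · subst hne; simp [h0.ne']
  have hex : ∃ n, σ n ≠ σ' n := Function.ne_iff.1 hne
  classical
  -- At the first differing digit the two tips lie in different first-level images, scaled by `α ^
  -- n`, whereas the binary values differ by at most `2⁻ⁿ = (α ^ n) ^ h`.
  set n := Nat.find hex
  have hlt : ∀ i < n, σ i = σ' i := fun i hi => not_not.1 (Nat.find_min hex hi)
  have h1 : σ n ≠ σ' n := Nat.find_spec hex
  have h2 : α ^ n * (1 - 2 * α ^ 2) ≤ dist (tip α σ) (tip α σ') := by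
    rw [dist_tip hα hα1 n σ σ' hlt]
    refine mul_le_mul_of_nonneg_left ?_ (by positivity)
    rw [tip_eq hα hα1 fun k => σ (k + n), tip_eq hα hα1 fun k => σ' (k + n)]
    exact le_dist_ifsMap hα (by simpa using h1) (tree_subset_box hα hq (tip_mem_tree hα hα1 _))
      (tree_subset_box hα hq (tip_mem_tree hα hα1 _))
  have h3 : ((2 : ℝ) ^ n)⁻¹ = (α ^ n) ^ h := by
    rw [← Real.rpow_natCast α, ← Real.rpow_mul hα.le, mul_comm, Real.rpow_mul hα.le,
      Real.rpow_natCast, show α ^ h = 2⁻¹ by linarith, inv_pow]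
  calc |Real.ofDigits σ - Real.ofDigits σ'| ≤ (((2 : ℕ) : ℝ) ^ n)⁻¹ :=
        Real.abs_ofDigits_sub_ofDigits_le hlt
    _ = (α ^ n) ^ h := by push_cast; exact h3
    _ ≤ ((1 - 2 * α ^ 2)⁻¹ * dist (tip α σ) (tip α σ')) ^ h := by
        refine Real.rpow_le_rpow (by positivity) ?_ h0.le
        rw [inv_mul_eq_div, le_div_iff₀ hc]
        exact h2
    _ = _ := Real.mul_rpow (by positivity) dist_nonneg

/-- Binary expansion of itineraries is an `h`-Hölder map from the tips onto a set containing
`[0,1]`, and such a map divides dimension by at least `h`. -/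
theorem le_dimH_tree {α h : ℝ} (hα : 0 < α) (hq : 2 * α ^ 2 < 1) (h0 : 0 < h)
    (hh : 2 * α ^ h = 1) : ENNReal.ofReal h ≤ dimH (tree α) := by
  have hα1 : α < 1 := by nlinarith
  have hc : 0 < 1 - 2 * α ^ 2 := by linarith
  have hch : 0 ≤ (1 - 2 * α ^ 2)⁻¹ ^ h := by positivity
  set g : Plane → ℕ → Fin 2 := Function.invFun (tip α) with hg
  have hgr : ∀ x ∈ range (tip α), tip α (g x) = x := fun x hx => Function.invFun_eq hx
  have hol : HolderOnWith (Real.toNNReal ((1 - 2 * α ^ 2)⁻¹ ^ h)) (Real.toNNReal h)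
      (fun x => Real.ofDigits (g x)) (range (tip α)) := by
    intro x hx y hy
    have h1 := abs_ofDigits_sub_le hα hq h0 hh (g x) (g y)
    rw [hgr x hx, hgr y hy] at h1
    rw [edist_dist, edist_dist, Real.coe_toNNReal _ h0.le,
      ENNReal.ofReal_rpow_of_nonneg dist_nonneg h0.le]
    change _ ≤ ENNReal.ofReal _ * _
    rw [← ENNReal.ofReal_mul hch]
    exact ENNReal.ofReal_le_ofReal h1
  have hsub : Icc (0 : ℝ) 1 ⊆ (fun x => Real.ofDigits (g x)) '' range (tip α) := by
    intro y hy
    obtain ⟨σ, -, rfl⟩ := Real.ofDigits_SurjOn one_lt_two hy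
    refine ⟨tip α σ, mem_range_self σ, ?_⟩
    -- The chosen itinerary need not be `σ` a priori; the Hölder estimate at distance zero shows
    -- that both have the same binary value.
    have h1 := abs_ofDigits_sub_le hα hq h0 hh (g (tip α σ)) σ
    rw [hgr _ (mem_range_self σ), dist_self, Real.zero_rpow h0.ne', mul_zero] at h1
    exact sub_eq_zero.1 (abs_nonpos_iff.1 h1)
  have h1 : (1 : ℝ≥0∞) ≤ dimH (range (tip α)) / ENNReal.ofReal h := by
    have hI : dimH (Icc (0 : ℝ) 1) = 1 := by
      simpa using Real.dimH_of_nonempty_interior (s := Icc (0 : ℝ) 1) (by simp)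
    calc (1 : ℝ≥0∞) = dimH (Icc (0 : ℝ) 1) := hI.symm
      _ ≤ _ := dimH_mono hsub
      _ ≤ _ := hol.dimH_image_le (by simpa using h0)
  rw [ENNReal.le_div_iff_mul_le (Or.inl (by simpa using h0)) (Or.inl ENNReal.ofReal_ne_top),
    one_mul] at h1
  exact h1.trans (dimH_mono (range_subset_iff.2 (tip_mem_tree hα hα1)))

end FractalFlow

/-! ### Room inside the rectangle and the inverse similarities -/

namespace FractalFlow

open Filter Topology
open scoped NNReal

/-- The interior of the rectangle `box α`. -/
def openBox (α : ℝ) : Set Plane := {x | |x 0| < 2 ∧ α * |x 1| < α ^ 2 + 1 / 2}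

theorem openBox_subset_box (α : ℝ) : openBox α ⊆ box α := fun _ hx => ⟨hx.1.le, hx.2.le⟩

theorem mapsTo_ifsMap_openBox {α : ℝ} (hα : 0 < α) (hq : 2 * α ^ 2 < 1) (i : Fin 2) :
    MapsTo (ifsMap α i) (box α) (openBox α) := by
  rintro x ⟨h0, h1⟩
  have h2 : |α * x 1| ≤ α ^ 2 + 1 / 2 := by rwa [abs_mul, abs_of_pos hα]
  rw [abs_le] at h2
  refine ⟨?_, ?_⟩
  · rw [abs_lt]
    fin_cases i
    · show -2 < ifsMap α 0 x 0 ∧ ifsMap α 0 x 0 < 2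
      rw [ifsMap_zero_apply_zero]; constructor <;> linarith
    · show -2 < ifsMap α 1 x 0 ∧ ifsMap α 1 x 0 < 2
      rw [ifsMap_one_apply_zero]; constructor <;> linarith
  · rw [ifsMap_apply_one, abs_mul, abs_of_pos hα]
    nlinarith [sq_nonneg α]

theorem exists_norm_le_of_mem_box {α : ℝ} (hα : 0 < α) : ∃ R, 0 ≤ R ∧ ∀ x ∈ box α, ‖x‖ ≤ R := by
  refine ⟨√(2 ^ 2 + ((α ^ 2 + 1 / 2) / α) ^ 2), Real.sqrt_nonneg _, fun x hx => ?_⟩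
  rw [EuclideanSpace.norm_eq, Fin.sum_univ_two]
  have h1 : |x 1| ≤ (α ^ 2 + 1 / 2) / α := by
    rw [le_div_iff₀ hα, mul_comm]; exact hx.2
  refine Real.sqrt_le_sqrt (add_le_add ?_ ?_)
  · exact pow_le_pow_left₀ (norm_nonneg _) hx.1 2
  · exact pow_le_pow_left₀ (norm_nonneg _) h1 2

/-- The inverses of the two similarities. -/
noncomputable def ifsInv (α : ℝ) (i : Fin 2) (x : Plane) : Plane :=
  rotEquiv.symm (α⁻¹ • (x - shift i))

theorem ifsMap_ifsInv {α : ℝ} (hα : 0 < α) (i : Fin 2) (x : Plane) :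
    ifsMap α i (ifsInv α i x) = x := by
  rw [ifsMap_apply, ifsInv, LinearIsometryEquiv.apply_symm_apply, smul_inv_smul₀ hα.ne',
    add_sub_cancel]

theorem ifsInv_ifsMap {α : ℝ} (hα : 0 < α) (i : Fin 2) (x : Plane) :
    ifsInv α i (ifsMap α i x) = x := by
  rw [ifsMap_apply, ifsInv, add_sub_cancel_left, inv_smul_smul₀ hα.ne',
    LinearIsometryEquiv.symm_apply_apply]

theorem continuous_ifsInv (α : ℝ) (i : Fin 2) : Continuous (ifsInv α i) :=
  rotEquiv.symm.continuous.comp (g := rotEquiv.symm) (f := fun x => α⁻¹ • (x - shift i))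
    (by fun_prop)

theorem ifsInv_notMem_box {α : ℝ} (hα : 0 < α) (hq : 2 * α ^ 2 < 1) {i j : Fin 2} (hij : i ≠ j)
    {x : Plane} (hx : ifsInv α i x ∈ box α) : ifsInv α j x ∉ box α := fun hx' => by
  have := le_dist_ifsMap hα hij hx hx'
  rw [ifsMap_ifsInv hα, ifsMap_ifsInv hα, dist_self] at this
  linarith

theorem ifsInv_notMem_box_of_notMem {α : ℝ} (hα : 0 < α) (hq : 2 * α ^ 2 < 1) (i : Fin 2)
    {x : Plane} (hx : x ∉ openBox α) : ifsInv α i x ∉ box α := fun hx' =>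
  hx (by simpa only [ifsMap_ifsInv hα] using mapsTo_ifsMap_openBox hα hq i hx')

/-! ### The generating field -/

/-- The conditions make `g(x₁) k(x₂)` equal `±x₂` near the two images of the box, so its
perpendicular gradient is `(±1, 0)` there, with support inside the open box and zero field on the
vertical axis. -/
theorem exists_profiles {α : ℝ} (hα : 0 < α) (hq : 2 * α ^ 2 < 1) :
    ∃ g k : ℝ → ℝ, ContDiff ℝ ∞ g ∧ ContDiff ℝ ∞ k ∧
      (∀ s, |s - 1| ≤ α ^ 2 + 1 / 2 → g =ᶠ[𝓝 s] fun _ => 1) ∧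
      (∀ s, |s + 1| ≤ α ^ 2 + 1 / 2 → g =ᶠ[𝓝 s] fun _ => -1) ∧
      (g =ᶠ[𝓝 0] fun _ => 0) ∧ (∀ s, 2 ≤ |s| → g =ᶠ[𝓝 s] fun _ => 0) ∧
      (∀ y, |y| ≤ 2 * α → k =ᶠ[𝓝 y] id) ∧
      (∀ y, α ^ 2 + 1 / 2 ≤ α * |y| → k =ᶠ[𝓝 y] fun _ => 0) := by
  set b := α ^ 2 + 1 / 2 with hb
  have hb0 : 0 < b := by positivity
  have hb1 : b < 1 := by linarith
  set c := b / α with hc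
  have hc1 : 2 * α < c := by rw [hc, lt_div_iff₀ hα]; nlinarith
  -- The transitions occupy the middle thirds of `(b, 1)` and `(2 α, c)`; both intervals are
  -- nonempty because `2 α ^ 2 < 1`.
  let β : ContDiffBump (1 : ℝ) := ⟨b + (1 - b) / 3, b + 2 * (1 - b) / 3, by linarith, by linarith⟩
  let κ : ContDiffBump (0 : ℝ) :=
    ⟨2 * α + (c - 2 * α) / 3, 2 * α + 2 * (c - 2 * α) / 3, by linarith, by linarith⟩
  have β1 : ∀ s, |s - 1| < b + (1 - b) / 3 → β s = 1 := fun s hs =>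
    β.one_of_mem_closedBall (by rw [Metric.mem_closedBall, Real.dist_eq]; exact hs.le)
  have β0 : ∀ s, b + 2 * (1 - b) / 3 < |s - 1| → β s = 0 := fun s hs =>
    β.zero_of_le_dist (by rw [Real.dist_eq]; exact hs.le)
  have κ1 : ∀ s, |s| < 2 * α + (c - 2 * α) / 3 → κ s = 1 := fun s hs =>
    κ.one_of_mem_closedBall (by rw [Metric.mem_closedBall, Real.dist_eq, sub_zero]; exact hs.le)
  have κ0 : ∀ s, 2 * α + 2 * (c - 2 * α) / 3 < |s| → κ s = 0 := fun s hs =>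
    κ.zero_of_le_dist (by rw [Real.dist_eq, sub_zero]; exact hs.le)
  refine ⟨fun s => β s - β (-s), fun y => y * κ y, ?_, ?_, ?_, ?_, ?_, ?_, ?_, ?_⟩
  · exact β.contDiff.sub (β.contDiff.comp contDiff_neg)
  · exact contDiff_id.mul κ.contDiff
  · intro s hs
    filter_upwards [(isOpen_lt (f := fun u : ℝ => |u - 1|) (by fun_prop) continuous_const).mem_nhds
      (show |s - 1| < b + (1 - b) / 3 by linarith)] with u hu
    have hu' : |u - 1| < b + (1 - b) / 3 := hu
    rw [β1 u hu', β0, sub_zero]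
    rw [abs_lt] at hu'
    rw [lt_abs]; right; linarith
  · intro s hs
    filter_upwards [(isOpen_lt (f := fun u : ℝ => |u + 1|) (by fun_prop) continuous_const).mem_nhds
      (show |s + 1| < b + (1 - b) / 3 by linarith)] with u hu
    have hu' : |u + 1| < b + (1 - b) / 3 := hu
    rw [β1 (-u) (by rw [← abs_neg]; convert hu' using 2; ring), β0, zero_sub]
    rw [abs_lt] at hu'
    rw [lt_abs]; right; linarith
  · filter_upwards [Ioo_mem_nhds (show -((1 - b) / 3) < 0 by linarith)
      (show 0 < (1 - b) / 3 by linarith)] with u hu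
    rw [β0, β0, sub_zero]
    · rw [lt_abs]; right; linarith [hu.1]
    · rw [lt_abs]; right; linarith [hu.2]
  · intro s hs
    filter_upwards [(isOpen_lt continuous_const continuous_abs).mem_nhds
      (show 1 + (b + 2 * (1 - b) / 3) < |s| by linarith)] with u hu
    have hu' : 1 + (b + 2 * (1 - b) / 3) < |u| := hu
    rw [β0, β0, sub_zero]
    · rcases lt_abs.1 hu' with h | h
      · rw [lt_abs]; right; linarith
      · rw [lt_abs]; left; linarith
    · rcases lt_abs.1 hu' with h | h
      · rw [lt_abs]; left; linarith
      · rw [lt_abs]; right; linarith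
  · intro y hy
    filter_upwards [(isOpen_lt continuous_abs continuous_const).mem_nhds
      (show |y| < 2 * α + (c - 2 * α) / 3 by linarith)] with u hu
    rw [κ1 u hu, mul_one, id]
  · intro y hy
    have hy' : c ≤ |y| := by rw [hc, div_le_iff₀ hα, mul_comm]; exact hy
    filter_upwards [(isOpen_lt continuous_const continuous_abs).mem_nhds
      (show 2 * α + 2 * (c - 2 * α) / 3 < |y| by linarith)] with u hu
    rw [κ0 u hu, mul_zero]

/-- The perpendicular gradient of `g(x₁) k(x₂)`. -/
noncomputable def perpGrad (g k : ℝ → ℝ) (x : Plane) : Plane :=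
  !₂[g (x 0) * deriv k (x 1), -(deriv g (x 0) * k (x 1))]

theorem contDiff_apply_plane (i : Fin 2) : ContDiff ℝ ∞ fun x : Plane => x i :=
  (EuclideanSpace.proj i : Plane →L[ℝ] ℝ).contDiff

theorem contDiff_deriv_of_contDiff {g : ℝ → ℝ} (hg : ContDiff ℝ ∞ g) : ContDiff ℝ ∞ (deriv g) :=
  (contDiff_infty_iff_deriv.1 hg).2

theorem contDiff_perpGrad {g k : ℝ → ℝ} (hg : ContDiff ℝ ∞ g) (hk : ContDiff ℝ ∞ k) :
    ContDiff ℝ ∞ (perpGrad g k) := by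
  rw [contDiff_euclidean]
  have h0 := contDiff_apply_plane 0
  have h1 := contDiff_apply_plane 1
  intro i
  fin_cases i
  · exact (hg.comp h0).mul ((contDiff_deriv_of_contDiff hk).comp h1)
  · exact (((contDiff_deriv_of_contDiff hg).comp h0).mul (hk.comp h1)).neg

theorem fderiv_mul_comp_apply {g k : ℝ → ℝ} (hg : ContDiff ℝ ∞ g) (hk : ContDiff ℝ ∞ k)
    (x v : Plane) : fderiv ℝ (fun x : Plane => g (x 0) * k (x 1)) x v =
      deriv g (x 0) * v 0 * k (x 1) + g (x 0) * (deriv k (x 1) * v 1) := by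
  have h : ∀ i, HasFDerivAt (fun x : Plane => x i) (EuclideanSpace.proj i : Plane →L[ℝ] ℝ) x :=
    fun i => (EuclideanSpace.proj i : Plane →L[ℝ] ℝ).hasFDerivAt
  have hg' := ((hg.differentiable (by simp)) (x 0)).hasDerivAt.comp_hasFDerivAt x (h 0)
  have hk' := ((hk.differentiable (by simp)) (x 1)).hasDerivAt.comp_hasFDerivAt x (h 1)
  have := (hg'.mul hk').fderiv
  rw [show (fun x : Plane => g (x 0) * k (x 1)) =
    (g ∘ fun x : Plane => x 0) * (k ∘ fun x : Plane => x 1) from rfl, this]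
  simp
  ring

theorem integral_mul_fderiv_eq_of_hasCompactSupport {f φ : Plane → ℝ} (hf : ContDiff ℝ ∞ f)
    (hφ : ContDiff ℝ ∞ φ) (hc : HasCompactSupport φ) (v : Plane) :
    ∫ x, f x * fderiv ℝ φ x v = -∫ x, fderiv ℝ f x v * φ x := by
  have hf' : Continuous fun x => fderiv ℝ f x v :=
    (hf.continuous_fderiv (by simp)).clm_apply continuous_const
  have hφ' : Continuous fun x => fderiv ℝ φ x v :=
    (hφ.continuous_fderiv (by simp)).clm_apply continuous_const
  refine integral_mul_fderiv_eq_neg_fderiv_mul_of_integrable ?_ ?_ ?_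
    (fun x _ => hf.differentiable (by simp) x) (fun x _ => hφ.differentiable (by simp) x)
  · exact (hf'.mul hφ.continuous).integrable_of_hasCompactSupport hc.mul_left
  · exact (hf.continuous.mul hφ').integrable_of_hasCompactSupport (hc.fderiv_apply ℝ v).mul_left
  · exact (hf.continuous.mul hφ.continuous).integrable_of_hasCompactSupport hc.mul_left

theorem weaklyDivFree_perpGrad {g k : ℝ → ℝ} (hg : ContDiff ℝ ∞ g) (hk : ContDiff ℝ ∞ k) :
    WeaklyDivFree (perpGrad g k) := by
  intro φ hφ hc
  have hg' := contDiff_deriv_of_contDiff hg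
  have hk' := contDiff_deriv_of_contDiff hk
  have hf0 : ContDiff ℝ ∞ fun x : Plane => g (x 0) * deriv k (x 1) :=
    (hg.comp (contDiff_apply_plane 0)).mul (hk'.comp (contDiff_apply_plane 1))
  have hf1 : ContDiff ℝ ∞ fun x : Plane => deriv g (x 0) * k (x 1) :=
    (hg'.comp (contDiff_apply_plane 0)).mul (hk.comp (contDiff_apply_plane 1))
  have hint : ∀ {f : Plane → ℝ}, ContDiff ℝ ∞ f → ∀ v : Plane,
      Integrable fun x => f x * fderiv ℝ φ x v := fun {f} hf v =>
    (hf.continuous.mul ((hφ.continuous_fderiv (by simp)).clm_apply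
      continuous_const)).integrable_of_hasCompactSupport (hc.fderiv_apply ℝ v).mul_left
  have hsplit : ∀ x, fderiv ℝ φ x (perpGrad g k x) =
      g (x 0) * deriv k (x 1) * fderiv ℝ φ x !₂[1, 0] -
        deriv g (x 0) * k (x 1) * fderiv ℝ φ x !₂[0, 1] := fun x => by
    have : perpGrad g k x = (g (x 0) * deriv k (x 1)) • (!₂[1, 0] : Plane) -
        (deriv g (x 0) * k (x 1)) • (!₂[0, 1] : Plane) := by
      ext i; fin_cases i <;> simp [perpGrad]
    rw [this, map_sub, map_smul, map_smul, smul_eq_mul, smul_eq_mul]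
  simp_rw [hsplit]
  rw [integral_sub (hint hf0 _) (hint hf1 _),
    integral_mul_fderiv_eq_of_hasCompactSupport hf0 hφ hc,
    integral_mul_fderiv_eq_of_hasCompactSupport hf1 hφ hc]
  -- Both integrations by parts produce the same mixed derivative `g' k'`, and the terms cancel.
  simp_rw [fderiv_mul_comp_apply hg hk', fderiv_mul_comp_apply hg' hk]
  simp

/-- A smooth divergence-free field, supported in the open rectangle, that equals `shift i` on the
image of the rectangle under the `i`-th similarity. -/
theorem exists_generator {α : ℝ} (hα : 0 < α) (hq : 2 * α ^ 2 < 1) :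
    ∃ U : Plane → Plane, ContDiff ℝ ∞ U ∧ (∀ x ∉ openBox α, U =ᶠ[𝓝 x] fun _ => 0) ∧
      (∀ i, ∀ x ∈ box α, U =ᶠ[𝓝 (ifsMap α i x)] fun _ => shift i) ∧
      (∀ y, U !₂[0, y] = 0) ∧ (∀ s, U !₂[s, 0] 1 = 0) ∧ WeaklyDivFree U := by
  obtain ⟨g, k, hg, hk, g1, g2, g0, gs, k1, ks⟩ := exists_profiles hα hq
  have hcont : ∀ (i : Fin 2) (x : Plane), Tendsto (fun y : Plane => y i) (𝓝 x) (𝓝 (x i)) :=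
    fun i x => (contDiff_apply_plane i).continuous.tendsto x
  refine ⟨perpGrad g k, contDiff_perpGrad hg hk, fun x hx => ?_, fun i x hx => ?_, fun y => ?_,
    fun s => ?_, weaklyDivFree_perpGrad hg hk⟩
  · have hx' : 2 ≤ |x 0| ∨ α ^ 2 + 1 / 2 ≤ α * |x 1| := by
      by_contra! h
      exact hx h
    rcases hx' with h | h
    · have h1 := gs _ h
      filter_upwards [(hcont 0 x).eventually h1, (hcont 0 x).eventually h1.deriv] with y hy hy'
      ext j; fin_cases j <;> simp [perpGrad, hy, hy']
    · have h1 := ks _ h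
      filter_upwards [(hcont 1 x).eventually h1, (hcont 1 x).eventually h1.deriv] with y hy hy'
      ext j; fin_cases j <;> simp [perpGrad, hy, hy']
  · have h1 := k1 (ifsMap α i x 1) (by
      rw [ifsMap_apply_one, abs_mul, abs_of_pos hα, mul_comm]
      exact mul_le_mul_of_nonneg_right hx.1 hα.le)
    have h2 : |α * x 1| ≤ α ^ 2 + 1 / 2 := by rw [abs_mul, abs_of_pos hα]; exact hx.2
    have h3 : g =ᶠ[𝓝 (ifsMap α i x 0)] fun _ => shift i 0 := by
      fin_cases i
      · refine g1 _ ?_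
        show |ifsMap α 0 x 0 - 1| ≤ _
        rw [ifsMap_zero_apply_zero, ← abs_neg]
        convert h2 using 2
        ring
      · refine g2 _ ?_
        show |ifsMap α 1 x 0 + 1| ≤ _
        rw [ifsMap_one_apply_zero, ← abs_neg]
        convert h2 using 2
        ring
    filter_upwards [(hcont 1 _).eventually h1.deriv, (hcont 0 _).eventually h3,
      (hcont 0 _).eventually h3.deriv] with y hk1 hg1 hg2
    have hs : shift i 1 = 0 := by fin_cases i <;> simp [shift]
    ext j; fin_cases j
    · simp [perpGrad, hk1, hg1]
    · simp [perpGrad, hg2, hs]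
  · have h1 := g0.eq_of_nhds
    have h2 := g0.deriv_eq
    ext j; fin_cases j <;> simp [perpGrad, h1, h2]
  · have h1 : k 0 = 0 := (k1 0 (by simpa using hα.le)).eq_of_nhds
    simp [perpGrad, h1]

end FractalFlow

namespace FractalFlow

open Filter Topology
open scoped NNReal

/-! ### The self-similar field -/

theorem WeaklyDivFree.integrable {V : Plane → Plane} (hV : Continuous V) {φ : Plane → ℝ}
    (hφ : ContDiff ℝ ∞ φ) (hc : HasCompactSupport φ) : Integrable fun x => fderiv ℝ φ x (V x) := by
  refine ((hφ.continuous_fderiv (by simp)).clm_apply hV).integrable_of_hasCompactSupport ?_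
  refine (hc.fderiv ℝ).mono fun x hx => ?_
  rw [Function.mem_support] at hx ⊢
  intro h
  exact hx (by rw [h]; rfl)

theorem WeaklyDivFree.add {V V' : Plane → Plane} (h : WeaklyDivFree V) (h' : WeaklyDivFree V')
    (hV : Continuous V) (hV' : Continuous V') : WeaklyDivFree fun x => V x + V' x := by
  intro φ hφ hc
  simp_rw [map_add]
  rw [integral_add (integrable hV hφ hc) (integrable hV' hφ hc), h φ hφ hc, h' φ hφ hc, add_zero]

theorem WeaklyDivFree.const_smul {V : Plane → Plane} (h : WeaklyDivFree V) (c : ℝ) :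
    WeaklyDivFree fun x => c • V x := by
  intro φ hφ hc
  simp_rw [map_smul]
  rw [integral_smul, h φ hφ hc, smul_zero]

/-- Weak divergence-freeness is invariant under similarities. -/
theorem WeaklyDivFree.conj {V : Plane → Plane} (h : WeaklyDivFree V) (R : Plane ≃ₗᵢ[ℝ] Plane)
    (e : Plane) {r : ℝ} (hr : r ≠ 0) :
    WeaklyDivFree fun x => r • R (V (R.symm (r⁻¹ • (x - e)))) := by
  intro φ hφ hc
  set Ψ : Plane → Plane := fun y => e + r • R y with hΨ
  set A : Plane →L[ℝ] Plane := r • (R : Plane →L[ℝ] Plane) with hA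
  have hΨd : ∀ y, HasFDerivAt Ψ A y := fun y => A.hasFDerivAt.const_add e
  have hΨs : ContDiff ℝ ∞ Ψ := contDiff_const.add A.contDiff
  have hemb : Topology.IsClosedEmbedding Ψ :=
    ((Homeomorph.addLeft e).isClosedEmbedding.comp
      (Homeomorph.smulOfNeZero r hr).isClosedEmbedding).comp R.toHomeomorph.isClosedEmbedding
  have h1 := h (φ ∘ Ψ) (hφ.comp hΨs) (hc.comp_isClosedEmbedding hemb)
  have h2 : ∀ y, fderiv ℝ (φ ∘ Ψ) y (V y) = fderiv ℝ φ (Ψ y) (r • R (V y)) := fun y => by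
    rw [((hφ.differentiable (by simp) (Ψ y)).hasFDerivAt.comp y (hΨd y)).fderiv]
    rfl
  simp_rw [h2] at h1
  set F : Plane → ℝ := fun x => fderiv ℝ φ x (r • R (V (R.symm (r⁻¹ • (x - e))))) with hF
  have h3 : ∀ y, fderiv ℝ φ (Ψ y) (r • R (V y)) = F (e + r • R y) := fun y => by
    simp only [hF, hΨ, add_sub_cancel_left, inv_smul_smul₀ hr, LinearIsometryEquiv.symm_apply_apply]
  simp_rw [h3] at h1
  have h4 : ∫ y, F (e + r • R y) = ∫ y, F (e + r • y) :=
    R.measurePreserving.integral_comp R.toHomeomorph.measurableEmbedding fun y => F (e + r • y)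
  -- The change of variables contributes only a nonzero Jacobian factor.
  rw [h4, Measure.integral_comp_smul volume (fun y => F (e + y)) r,
    integral_add_left_eq_self F e, smul_eq_zero] at h1
  exact h1.resolve_left (by positivity)

/-- The operator whose fixed point is the self-similar field. -/
noncomputable def renormalize (α : ℝ) (U₀ V : Plane → Plane) (x : Plane) : Plane :=
  U₀ x + (linPart α (V (ifsInv α 0 x)) + linPart α (V (ifsInv α 1 x)))

theorem norm_linPart {α : ℝ} (hα : 0 < α) (x : Plane) : ‖linPart α x‖ = α * ‖x‖ := by
  simpa using norm_linPart_pow hα 1 x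

theorem renormalize_eq_of_mem {α : ℝ} (hα : 0 < α) (hq : 2 * α ^ 2 < 1) {U₀ V : Plane → Plane}
    {i : Fin 2} {x : Plane} (hV : ∀ y ∉ box α, V y = 0) (hx : ifsInv α i x ∈ box α) :
    renormalize α U₀ V x = U₀ x + linPart α (V (ifsInv α i x)) := by
  fin_cases i
  · have := hV _ (ifsInv_notMem_box hα hq (i := 0) (j := 1) (by decide) hx)
    simp [renormalize, this]
  · have := hV _ (ifsInv_notMem_box hα hq (i := 1) (j := 0) (by decide) hx)
    simp [renormalize, this]

theorem renormalize_eq_of_forall_notMem {α : ℝ} {U₀ V : Plane → Plane} {x : Plane}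
    (hV : ∀ y ∉ box α, V y = 0) (hx : ∀ i, ifsInv α i x ∉ box α) : renormalize α U₀ V x = U₀ x := by
  simp [renormalize, hV _ (hx 0), hV _ (hx 1)]

/-- At most one of the two copies is nonzero at any point, so the contraction factor is `α` rather
than `2 α`, which may exceed `1`. -/
theorem norm_renormalize_sub_le {α : ℝ} (hα : 0 < α) (hq : 2 * α ^ 2 < 1) {U₀ V V' : Plane → Plane}
    (hV : ∀ y ∉ box α, V y = 0) (hV' : ∀ y ∉ box α, V' y = 0) {C : ℝ}
    (hC : ∀ x, ‖V x - V' x‖ ≤ C) (x : Plane) :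
    ‖renormalize α U₀ V x - renormalize α U₀ V' x‖ ≤ α * C := by
  by_cases hx : ∃ i, ifsInv α i x ∈ box α
  · obtain ⟨i, hi⟩ := hx
    rw [renormalize_eq_of_mem hα hq hV hi, renormalize_eq_of_mem hα hq hV' hi, add_sub_add_left_eq_sub,
      ← map_sub, norm_linPart hα]
    exact mul_le_mul_of_nonneg_left (hC _) hα.le
  · push Not at hx
    rw [renormalize_eq_of_forall_notMem hV hx, renormalize_eq_of_forall_notMem hV' hx, sub_self, norm_zero]
    exact mul_nonneg hα.le ((norm_nonneg _).trans (hC 0))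

/-- Differentiable fields with derivative bounded by `L`, vanishing near every point outside of the
open rectangle, and weakly divergence-free. -/
structure IsAdmissible (α L : ℝ) (V : Plane → Plane) : Prop where
  differentiable : Differentiable ℝ V
  norm_fderiv_le : ∀ x, ‖fderiv ℝ V x‖ ≤ L
  eventually_eq_zero : ∀ x ∉ openBox α, V =ᶠ[𝓝 x] fun _ => 0
  weaklyDivFree : WeaklyDivFree V

theorem IsAdmissible.eq_zero {α L : ℝ} {V : Plane → Plane} (hV : IsAdmissible α L V) :
    ∀ x ∉ box α, V x = 0 := fun x hx =>
  (hV.eventually_eq_zero x fun h => hx (openBox_subset_box α h)).eq_of_nhds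

/-- The derivative of a copy is `(α 𝓡) DV (α 𝓡)⁻¹`, again bounded by `L`. At each point at most one
of the derivatives of `U₀` and of the two copies is nonzero, so the bounds do not add up. -/
theorem IsAdmissible.step {α L : ℝ} (hα : 0 < α) (hq : 2 * α ^ 2 < 1) {U₀ V : Plane → Plane}
    (hU : IsAdmissible α L U₀)
    (hUc : ∀ i, ∀ x ∈ box α, U₀ =ᶠ[𝓝 (ifsMap α i x)] fun _ => shift i)
    (hV : IsAdmissible α L V) : IsAdmissible α L (renormalize α U₀ V) := by
  set B : Plane →L[ℝ] Plane := α⁻¹ • (rotEquiv.symm : Plane →L[ℝ] Plane) with hB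
  have hBn : ‖B‖ ≤ α⁻¹ := ContinuousLinearMap.opNorm_le_bound _ (by positivity) fun x => by
    rw [hB, smul_apply, norm_smul, Real.norm_eq_abs,
      abs_of_pos (inv_pos.2 hα)]
    exact le_of_eq (congrArg _ (rotEquiv.symm.norm_map x))
  have hAn : ‖linPart α‖ ≤ α := ContinuousLinearMap.opNorm_le_bound _ hα.le fun x =>
    (norm_linPart hα x).le
  have hinv : ∀ i x, HasFDerivAt (ifsInv α i) B x := fun i x => by
    have h := (B.hasFDerivAt (x := x)).sub_const (B (shift i))
    refine h.congr_of_eventuallyEq (.of_forall fun y => ?_)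
    simp only [ifsInv, map_smul, hB, smul_apply, ← smul_sub, map_sub]
    rfl
  have hpiece : ∀ i x, HasFDerivAt (fun y => linPart α (V (ifsInv α i y)))
      (linPart α ∘L fderiv ℝ V (ifsInv α i x) ∘L B) x := fun i x =>
    (linPart α).hasFDerivAt.comp x
      ((hV.differentiable (ifsInv α i x)).hasFDerivAt.comp x (hinv i x))
  have hpiece0 : ∀ i x, ifsInv α i x ∉ openBox α →
      linPart α ∘L fderiv ℝ V (ifsInv α i x) ∘L B = 0 := fun i x hx => by
    rw [(hV.eventually_eq_zero _ hx).fderiv_eq]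
    ext; simp
  have hderiv : ∀ x, HasFDerivAt (renormalize α U₀ V) (fderiv ℝ U₀ x +
      (linPart α ∘L fderiv ℝ V (ifsInv α 0 x) ∘L B +
        linPart α ∘L fderiv ℝ V (ifsInv α 1 x) ∘L B)) x := fun x =>
    (hU.differentiable x).hasFDerivAt.add ((hpiece 0 x).add (hpiece 1 x))
  have hle : ∀ i x, ‖linPart α ∘L fderiv ℝ V (ifsInv α i x) ∘L B‖ ≤ L := fun i x => by
    calc ‖linPart α ∘L fderiv ℝ V (ifsInv α i x) ∘L B‖
        ≤ ‖linPart α‖ * (‖fderiv ℝ V (ifsInv α i x)‖ * ‖B‖) :=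
          (ContinuousLinearMap.opNorm_comp_le _ _).trans
            (mul_le_mul_of_nonneg_left (ContinuousLinearMap.opNorm_comp_le _ _) (norm_nonneg _))
      _ ≤ α * (L * α⁻¹) := by
          have := hV.norm_fderiv_le (ifsInv α i x)
          have hL : 0 ≤ L := (norm_nonneg _).trans this
          gcongr
      _ = L := by field_simp
  have hU0 : ∀ i x, ifsInv α i x ∈ openBox α → fderiv ℝ U₀ x = 0 := fun i x hx => by
    have := hUc i _ (openBox_subset_box α hx)
    rw [ifsMap_ifsInv hα] at this
    rw [this.fderiv_eq]
    simp
  refine ⟨fun x => (hderiv x).differentiableAt, fun x => ?_, fun x hx => ?_, ?_⟩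
  · rw [(hderiv x).fderiv]
    by_cases h0 : ifsInv α 0 x ∈ openBox α
    · have h1 : ifsInv α 1 x ∉ openBox α := fun h =>
        ifsInv_notMem_box hα hq (i := 0) (j := 1) (by decide) (openBox_subset_box α h0)
          (openBox_subset_box α h)
      rw [hU0 0 x h0, hpiece0 1 x h1, zero_add, add_zero]
      exact hle 0 x
    by_cases h1 : ifsInv α 1 x ∈ openBox α
    · rw [hU0 1 x h1, hpiece0 0 x h0, zero_add, zero_add]
      exact hle 1 x
    · rw [hpiece0 0 x h0, hpiece0 1 x h1, add_zero, add_zero]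
      exact hU.norm_fderiv_le x
  · have hi : ∀ i, ∀ᶠ y in 𝓝 x, V (ifsInv α i y) = 0 := fun i =>
      ((continuous_ifsInv α i).tendsto x).eventually (hV.eventually_eq_zero _
        fun h => ifsInv_notMem_box_of_notMem hα hq i hx (openBox_subset_box α h))
    filter_upwards [hU.eventually_eq_zero x hx, hi 0, hi 1] with y h1 h2 h3
    simp [renormalize, h1, h2, h3]
  · have hc : ∀ i, Continuous fun x => linPart α (V (ifsInv α i x)) := fun i =>
      (linPart α).continuous.comp (hV.differentiable.continuous.comp (continuous_ifsInv α i))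
    have hd : ∀ i, WeaklyDivFree fun x => linPart α (V (ifsInv α i x)) := fun i =>
      hV.weaklyDivFree.conj rotEquiv (shift i) hα.ne'
    exact hU.weaklyDivFree.add ((hd 0).add (hd 1) (hc 0) (hc 1)) hU.differentiable.continuous
      ((hc 0).add (hc 1))

theorem WeaklyDivFree.of_tendsto {V : ℕ → Plane → Plane} {U : Plane → Plane} {M : ℝ}
    (hV : ∀ n, WeaklyDivFree (V n)) (hc : ∀ n, Continuous (V n)) (hM : ∀ n x, ‖V n x‖ ≤ M)
    (hlim : ∀ x, Tendsto (fun n => V n x) atTop (𝓝 (U x))) : WeaklyDivFree U := by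
  intro φ hφ hcs
  have hφ' : Continuous (fderiv ℝ φ) := hφ.continuous_fderiv (by simp)
  have h := tendsto_integral_of_dominated_convergence
    (F := fun n x => fderiv ℝ φ x (V n x)) (f := fun x => fderiv ℝ φ x (U x)) (μ := volume)
    (fun x => ‖fderiv ℝ φ x‖ * M) (fun n => (hφ'.clm_apply (hc n)).aestronglyMeasurable)
    ((hφ'.norm.integrable_of_hasCompactSupport (hcs.fderiv ℝ).norm).mul_const M)
    (fun n => .of_forall fun x => (ContinuousLinearMap.le_opNorm _ _).trans
      (mul_le_mul_of_nonneg_left (hM n x) (norm_nonneg _)))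
    (.of_forall fun x => ((fderiv ℝ φ x).continuous.tendsto _).comp (hlim x))
  simp_rw [fun n => hV n φ hφ hcs] at h
  exact tendsto_nhds_unique h tendsto_const_nhds

/-- A bounded Lipschitz divergence-free field supported in the rectangle that is equivariant under
both similarities and tangent to the segment. -/
theorem exists_selfSimilar_field {α : ℝ} (hα : 0 < α) (hq : 2 * α ^ 2 < 1) :
    ∃ (U : Plane → Plane) (L M : ℝ≥0), LipschitzWith L U ∧ (∀ x, ‖U x‖ ≤ M) ∧
      (∀ x ∉ box α, U x = 0) ∧ WeaklyDivFree U ∧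
      (∀ i, ∀ x ∈ box α, U (ifsMap α i x) = shift i + α • rotEquiv (U x)) ∧
      U 0 = 0 ∧ ∀ s, U !₂[s, 0] 1 = 0 := by
  have hα1 : α < 1 := by nlinarith
  obtain ⟨U₀, hs, h0, hU, hstem, hseg, hdiv⟩ := exists_generator hα hq
  obtain ⟨R, -, hR⟩ := exists_norm_le_of_mem_box hα
  have hcs : HasCompactSupport U₀ := by
    refine HasCompactSupport.of_support_subset_isCompact (isCompact_closedBall 0 R) fun x hx => ?_
    refine mem_closedBall_zero_iff.2 (hR x (openBox_subset_box α ?_))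
    by_contra h
    exact hx (h0 x h).eq_of_nhds
  obtain ⟨C, hC⟩ := hcs.exists_bound_of_continuous hs.continuous
  obtain ⟨L, hL⟩ := (hcs.fderiv ℝ).exists_bound_of_continuous (hs.continuous_fderiv (by simp))
  have hC0 : 0 ≤ C := (norm_nonneg _).trans (hC 0)
  have hL0 : 0 ≤ L := (norm_nonneg _).trans (hL 0)
  have hadm : IsAdmissible α L U₀ := ⟨hs.differentiable (by simp), hL, h0, hdiv⟩
  set V : ℕ → Plane → Plane := fun n => (renormalize α U₀)^[n] U₀ with hV
  have hVs : ∀ n, V (n + 1) = renormalize α U₀ (V n) := fun n => Function.iterate_succ_apply' _ _ _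
  have hVa : ∀ n, IsAdmissible α L (V n) := fun n => by
    induction n with
    | zero => exact hadm
    | succ n ih => rw [hVs]; exact hadm.step hα hq hU ih
  have hdist : ∀ n x, ‖V n x - V (n + 1) x‖ ≤ C * α ^ n := fun n => by
    induction n with
    | zero =>
      intro x
      rw [hVs, pow_zero, mul_one]
      show ‖U₀ x - renormalize α U₀ U₀ x‖ ≤ C
      by_cases hx : ∃ i, ifsInv α i x ∈ box α
      · obtain ⟨i, hi⟩ := hx
        rw [renormalize_eq_of_mem hα hq hadm.eq_zero hi, sub_add_cancel_left, norm_neg, norm_linPart hα]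
        nlinarith [hC (ifsInv α i x), norm_nonneg (U₀ (ifsInv α i x))]
      · push Not at hx
        rw [renormalize_eq_of_forall_notMem hadm.eq_zero hx, sub_self, norm_zero]
        exact hC0
    | succ n ih =>
      intro x
      rw [hVs (n + 1), hVs n, pow_succ', mul_left_comm]
      exact norm_renormalize_sub_le hα hq (hVa n).eq_zero (by rw [← hVs]; exact (hVa (n + 1)).eq_zero)
        (by rw [← hVs]; exact ih) x
  have hbound : ∀ n x, ‖V n x‖ ≤ C / (1 - α) := fun n => by
    have h1 : 0 < 1 - α := by linarith
    have h2 : C + α * (C / (1 - α)) = C / (1 - α) := by field_simp; ring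
    have h3 : C ≤ C / (1 - α) := by
      rw [← h2]; exact le_add_of_nonneg_right (by positivity)
    induction n with
    | zero => exact fun x => (hC x).trans h3
    | succ n ih =>
      intro x
      rw [hVs]
      by_cases hx : ∃ i, ifsInv α i x ∈ box α
      · obtain ⟨i, hi⟩ := hx
        rw [renormalize_eq_of_mem hα hq (hVa n).eq_zero hi, ← h2]
        refine (norm_add_le _ _).trans (add_le_add (hC x) ?_)
        rw [norm_linPart hα]
        exact mul_le_mul_of_nonneg_left (ih _) hα.le
      · push Not at hx
        rw [renormalize_eq_of_forall_notMem (hVa n).eq_zero hx]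
        exact (hC x).trans h3
  have hlim : ∀ x, ∃ y, Tendsto (fun n => V n x) atTop (𝓝 y) := fun x =>
    cauchySeq_tendsto_of_complete (cauchySeq_of_le_geometric α C hα1 fun n => by
      rw [dist_eq_norm]; exact hdist n x)
  choose U hUlim using hlim
  have hU0 : ∀ x ∉ box α, U x = 0 := fun x hx =>
    tendsto_nhds_unique (hUlim x) (by simp_rw [fun n => (hVa n).eq_zero x hx]; exact tendsto_const_nhds)
  have hfix : ∀ x, U x = renormalize α U₀ U x := fun x => by
    refine tendsto_nhds_unique ((hUlim x).comp (tendsto_add_atTop_nat 1)) ?_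
    have : ∀ n, (fun n => V n x) (n + 1) = renormalize α U₀ (V n) x := fun n => congrFun (hVs n) x
    rw [Function.comp_def]
    simp_rw [this]
    exact tendsto_const_nhds.add ((((linPart α).continuous.tendsto _).comp (hUlim _)).add
      (((linPart α).continuous.tendsto _).comp (hUlim _)))
  have hequiv : ∀ i, ∀ x ∈ box α, U (ifsMap α i x) = shift i + α • rotEquiv (U x) :=
    fun i x hx => by
    rw [hfix, renormalize_eq_of_mem hα hq (i := i) hU0 (by rwa [ifsInv_ifsMap hα]), ifsInv_ifsMap hα,
      (hU i x hx).eq_of_nhds, linPart_apply]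
  have hne : ∀ (i : Fin 2) (x : Plane), x ∈ box α → ifsMap α i x 0 ≠ 0 := fun i x hx h => by
    have h2 : |α * x 1| ≤ α ^ 2 + 1 / 2 := by rw [abs_mul, abs_of_pos hα]; exact hx.2
    rw [abs_le] at h2
    fin_cases i
    · have h3 : ifsMap α 0 x 0 = 0 := h
      rw [ifsMap_zero_apply_zero] at h3
      linarith
    · have h3 : ifsMap α 1 x 0 = 0 := h
      rw [ifsMap_one_apply_zero] at h3
      linarith
  -- Neither image of the box meets the vertical axis, so no copy contributes there and `U` agrees
  -- with `U₀`.
  have hstemU : ∀ y, U !₂[0, y] = 0 := fun y => by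
    rw [hfix, renormalize_eq_of_forall_notMem hU0, hstem]
    intro i hi
    refine hne i _ hi ?_
    rw [ifsMap_ifsInv hα]
    simp
  refine ⟨U, L.toNNReal, (C / (1 - α)).toNNReal, ?_, fun x => ?_, hU0, ?_, hequiv, ?_, fun s => ?_⟩
  · refine LipschitzWith.of_dist_le_mul fun x y => ?_
    refine le_of_tendsto' ((hUlim x).dist (hUlim y)) fun n => ?_
    refine (lipschitzWith_of_nnnorm_fderiv_le (C := L.toNNReal) (hVa n).differentiable
      fun z => ?_).dist_le_mul x y
    rw [← NNReal.coe_le_coe, Real.coe_toNNReal _ hL0]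
    exact (hVa n).norm_fderiv_le z
  · rw [Real.coe_toNNReal _ (div_nonneg hC0 (by linarith))]
    exact le_of_tendsto' (hUlim x).norm fun n => hbound n x
  · exact WeaklyDivFree.of_tendsto (fun n => (hVa n).weaklyDivFree)
      (fun n => (hVa n).differentiable.continuous) hbound hUlim
  · have h00 : (0 : Plane) = !₂[0, 0] := by ext i; fin_cases i <;> simp
    exact (congrArg U h00).trans (hstemU 0)
  -- A point of the horizontal axis in an image of the box comes from the vertical axis, where `U`
  -- vanishes; equivariance then gives the horizontal value `shift i`.
  · by_cases hx : ∃ i, ifsInv α i !₂[s, 0] ∈ box α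
    · obtain ⟨i, hi⟩ := hx
      have h1 := hequiv i _ hi
      rw [ifsMap_ifsInv hα] at h1
      have h2 : ifsInv α i !₂[s, 0] = !₂[0, ifsInv α i !₂[s, 0] 1] := by
        have h3 := ifsMap_apply_one α i (ifsInv α i !₂[s, 0])
        rw [ifsMap_ifsInv hα] at h3
        have h4 : ifsInv α i !₂[s, 0] 0 = 0 := by
          simpa [hα.ne'] using h3.symm
        ext j; fin_cases j
        · exact h4
        · rfl
      rw [h1, h2, hstemU, map_zero, smul_zero, add_zero]
      fin_cases i <;> simp [shift]
    · push Not at hx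
      rw [hfix, renormalize_eq_of_forall_notMem hU0 hx, hseg]

end FractalFlow

namespace FractalFlow

open Filter Topology
open scoped NNReal

/-! ### The collapsing velocity field -/

section Collapse

variable {E : Type*} [NormedAddCommGroup E] [NormedSpace ℝ E]

/-- The velocity field `λ'(t) U(x / λ(t))` with `λ(t) = (1 - t)²`. -/
noncomputable def collapse (U : E → E) (t : ℝ) (x : E) : E :=
  (-2 * (1 - t)) • U (((1 - t) ^ 2)⁻¹ • x)

theorem hasDerivAt_scale (t : ℝ) : HasDerivAt (fun t : ℝ => (1 - t) ^ 2) (-2 * (1 - t)) t := by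
  have := ((hasDerivAt_id t).const_sub 1).fun_pow 2
  simpa using this

/-- At `t = 1` the argument of `U` is uncontrolled, but `U` is bounded and `λ'(1) = 0`; this is why
`λ` is quadratic rather than linear. -/
theorem continuous_collapse {U : E → E} {M : ℝ≥0} (hU : Continuous U) (hM : ∀ x, ‖U x‖ ≤ M) :
    Continuous fun p : ℝ × E => collapse U p.1 p.2 := by
  rw [continuous_iff_continuousAt]
  rintro ⟨t, x⟩
  by_cases ht : 1 - t = 0
  · have h0 : collapse U t x = 0 := by simp [collapse, ht]
    rw [ContinuousAt, h0]
    refine squeeze_zero_norm (a := fun p : ℝ × E => |-2 * (1 - p.1)| * M) (fun p => ?_) ?_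
    · rw [collapse, norm_smul, Real.norm_eq_abs]
      exact mul_le_mul_of_nonneg_left (hM _) (abs_nonneg _)
    · have hc : Continuous fun p : ℝ × E => |-2 * (1 - p.1)| * (M : ℝ) := by fun_prop
      convert hc.tendsto (t, x) using 2
      simp [ht]
  · have h1 : ContinuousAt (fun p : ℝ × E => ((1 - p.1) ^ 2)⁻¹ • p.2) (t, x) :=
      (ContinuousAt.inv₀ (f := fun p : ℝ × E => (1 - p.1) ^ 2) (by fun_prop)
        (pow_ne_zero 2 ht)).smul continuousAt_snd
    exact ContinuousAt.smul (by fun_prop) (hU.continuousAt.comp h1)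

theorem isTamed_collapse {U : E → E} {L M : ℝ≥0} (hU : LipschitzWith L U) (hM : ∀ x, ‖U x‖ ≤ M) :
    IsTamed (collapse U) where
  continuous := continuous_collapse hU.continuous hM
  bounded := ⟨2 * M, fun t ht x => by
    rw [collapse, norm_smul, Real.norm_eq_abs, NNReal.coe_mul]
    refine mul_le_mul ?_ (hM _) (norm_nonneg _) (by positivity)
    rw [abs_le, NNReal.coe_ofNat]
    constructor <;> linarith [ht.1, ht.2]⟩
  lipschitz := fun T hT => by
    refine ⟨2 * (L * (((1 - T) ^ 2)⁻¹).toNNReal), fun t ht => ?_⟩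
    refine LipschitzWith.of_dist_le_mul fun x y => ?_
    have hT' : 0 < 1 - T := by linarith
    have ht' : 1 - T ≤ 1 - t := by linarith [ht.2]
    rw [collapse, collapse, dist_smul₀, Real.norm_eq_abs, NNReal.coe_mul, NNReal.coe_mul,
      NNReal.coe_ofNat, Real.coe_toNNReal _ (by positivity), mul_assoc, mul_assoc]
    refine mul_le_mul ?_ ((hU.dist_le_mul _ _).trans ?_) dist_nonneg (by positivity)
    · rw [abs_le]; constructor <;> linarith [ht.1]
    · rw [dist_smul₀, Real.norm_eq_abs, abs_of_nonneg (by positivity)]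
      gcongr

theorem isSolution_smul {U : E → E} {a : E} (ha : U a = a) {T : ℝ} (hT : T < 1) :
    IsSolution T (collapse U) fun t => (1 - t) ^ 2 • a := fun t ht => by
  have h1 : (1 - t) ^ 2 ≠ 0 := pow_ne_zero 2 (by linarith [ht.2])
  rw [collapse, inv_smul_smul₀ h1, ha]
  exact ((hasDerivAt_scale t).smul_const a).hasDerivWithinAt

end Collapse

/-- Since `λ ≤ 1` on `[0,1]`, the space-time support is bounded, so continuity upgrades to uniform
continuity. -/
theorem uniformContinuousOn_collapse {α : ℝ} (hα : 0 < α) {U : Plane → Plane} {M : ℝ≥0}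
    (hU : Continuous U) (hM : ∀ x, ‖U x‖ ≤ M) (h0 : ∀ x ∉ box α, U x = 0) :
    UniformContinuousOn (fun p : ℝ × Plane => collapse U p.1 p.2) (Icc 0 1 ×ˢ univ) := by
  obtain ⟨R, hR0, hR⟩ := exists_norm_le_of_mem_box hα
  set G : Icc (0 : ℝ) 1 × Plane → Plane := fun p => collapse U p.1 p.2 with hG
  have hGc : Continuous G := (continuous_collapse hU hM).comp
    ((continuous_subtype_val.comp continuous_fst).prodMk continuous_snd)
  have hGs : HasCompactSupport G := by
    refine HasCompactSupport.of_support_subset_isCompact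
      (isCompact_univ.prod (isCompact_closedBall (0 : Plane) R)) fun p hp => ⟨trivial, ?_⟩
    rw [mem_closedBall_zero_iff]
    have hne : 1 - (p.1 : ℝ) ≠ 0 := fun h => hp (by simp [hG, collapse, h])
    have hmem : ((1 - (p.1 : ℝ)) ^ 2)⁻¹ • p.2 ∈ box α := by
      by_contra h
      exact hp (by simp [hG, collapse, h0 _ h])
    have h1 := hR _ hmem
    have h2 : 0 < (1 - (p.1 : ℝ)) ^ 2 := by positivity
    have h3 : (1 - (p.1 : ℝ)) ^ 2 ≤ 1 := by nlinarith [p.1.2.1, p.1.2.2]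
    rw [norm_smul, Real.norm_eq_abs, abs_of_pos (inv_pos.2 h2), inv_mul_le_iff₀ h2] at h1
    nlinarith
  rw [uniformContinuousOn_iff_restrict]
  exact (hGs.uniformContinuous_of_continuous hGc).comp
    (f := fun p : (Icc (0 : ℝ) 1 ×ˢ (univ : Set Plane) : Set (ℝ × Plane)) =>
      ((⟨p.1.1, p.2.1⟩, p.1.2) : Icc (0 : ℝ) 1 × Plane))
    (((uniformContinuous_fst.comp uniformContinuous_subtype_val).subtype_mk _).prodMk
      (uniformContinuous_snd.comp uniformContinuous_subtype_val))

theorem weaklyDivFree_collapse {U : Plane → Plane} (hU : WeaklyDivFree U) (t : ℝ) :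
    WeaklyDivFree (collapse U t) := by
  rcases eq_or_ne ((1 - t) ^ 2) 0 with h | h
  · have h' : 1 - t = 0 := by simpa using h
    intro φ _ _
    simp [collapse, h']
  -- Dilating `U` by `λ` gives `λ U(x / λ)`; the constant `λ' / λ` corrects the amplitude.
  · convert ((hU.conj (LinearIsometryEquiv.refl ℝ Plane) 0 h).const_smul
      (-2 * (1 - t) * ((1 - t) ^ 2)⁻¹)) using 2 with x
    simp [collapse, smul_smul, mul_assoc, inv_mul_cancel₀ h]
    rfl

/-- In one dimension, solutions starting between two fixed points stay between the corresponding
homothetic solutions. -/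
theorem abs_le_of_isSolution_collapse {g : ℝ → ℝ} {L M : ℝ≥0} (hg : LipschitzWith L g)
    (hM : ∀ s, ‖g s‖ ≤ M) (h1 : g 1 = 1) (h2 : g (-1) = -1) {x : ℝ → ℝ}
    (hx : IsSolution 1 (collapse g) x) (h0 : |x 0| ≤ 1) {t : ℝ} (ht : t ∈ Ico (0 : ℝ) 1) :
    |x t| ≤ (1 - t) ^ 2 := by
  -- Backward uniqueness: a solution meeting `λ(s) a` at some `s < 1` must have started at `a`. The
  -- intermediate value theorem then forbids crossing.
  have key : ∀ a : ℝ, g a = a → x 0 ≠ a → ∀ s ∈ Icc 0 t, x s - (1 - s) ^ 2 * a ≠ 0 := by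
    intro a ha hne s hs h
    have hs1 : s < 1 := hs.2.trans_lt ht.2
    obtain ⟨K, hK⟩ := (isTamed_collapse hg hM).lipschitz s hs1
    have := (hx.mono hs1.le).dist_zero_le hK (isSolution_smul ha hs1) hs.1
    simp only [smul_eq_mul, sub_zero, one_pow, one_mul] at this
    rw [sub_eq_zero.1 h, dist_self, zero_mul] at this
    exact hne (dist_le_zero.1 this)
  have hcont : ∀ a : ℝ, ContinuousOn (fun s => x s - (1 - s) ^ 2 * a) (Icc 0 t) := fun a =>
    (hx.continuousOn.mono (Icc_subset_Icc_right ht.2.le)).sub (by fun_prop)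
  have hp : IsPreconnected (Icc (0 : ℝ) t) := isPreconnected_Icc
  have hl : (0 : ℝ) ∈ Icc 0 t := left_mem_Icc.2 ht.1
  have hr : t ∈ Icc 0 t := right_mem_Icc.2 ht.1
  obtain ⟨K, hK⟩ := (isTamed_collapse hg hM).lipschitz t ht.2
  have hedge : ∀ a : ℝ, g a = a → x 0 = a → x t = (1 - t) ^ 2 * a := fun a ha h =>
    (hx.mono ht.2.le).eqOn hK (isSolution_smul ha ht.2) (by simp [h]) hr
  rw [abs_le] at h0 ⊢
  constructor
  · by_cases h : x 0 = -1
    · rw [hedge _ h2 h]; linarith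
    · by_contra! hlt
      obtain ⟨s, hs, hs0⟩ := hp.intermediate_value hr hl (hcont (-1))
        (show (0 : ℝ) ∈ Icc _ _ from ⟨by linarith, by simpa using by linarith [h0.1]⟩)
      exact key _ h2 h s hs hs0
  · by_cases h : x 0 = 1
    · rw [hedge _ h1 h]; linarith
    · by_contra! hlt
      obtain ⟨s, hs, hs0⟩ := hp.intermediate_value hl hr (hcont 1)
        (show (0 : ℝ) ∈ Icc _ _ from ⟨by simpa using h0.2, by linarith⟩)
      exact key _ h1 h s hs hs0

/-- Confinement is proved for all `t < 1` at once, because invariance under `F i` solves the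
equation on all of `[0,t]` and so needs the rescaled trajectory of `a` in the box at every earlier
time. -/
theorem inv_smul_mem_box {α : ℝ} {U : Plane → Plane} {L M : ℝ≥0} (hα : 0 < α)
    (hq : 2 * α ^ 2 < 1) (hL : LipschitzWith L U) (hM : ∀ x, ‖U x‖ ≤ M)
    (heq : ∀ i, ∀ x ∈ box α, U (ifsMap α i x) = shift i + α • rotEquiv (U x)) (h0 : U 0 = 0)
    (hseg : ∀ s, U !₂[s, 0] 1 = 0) {X : ℝ → Plane → Plane}
    (hX : IsTrajectoryMap 1 (collapse U) X) {t : ℝ} (ht : t ∈ Ico (0 : ℝ) 1) {a : Plane}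
    (ha : a ∈ tree α) : ((1 - t) ^ 2)⁻¹ • X t a ∈ box α := by
  have hW := isTamed_collapse hL hM
  have hsol : ∀ a, IsSolution 1 (collapse U) fun t => X t a := fun a => (hX a).2
  have h00 : (0 : Plane) ∈ box α := ⟨by simp, by simp; positivity⟩
  have hlam : ∀ {t : ℝ}, t ∈ Ico (0 : ℝ) 1 → (1 - t) ^ 2 ≠ 0 := fun {t} ht =>
    pow_ne_zero 2 (by linarith [ht.2])
  set G : Set Plane := {a | ∀ t ∈ Ico (0 : ℝ) 1, ((1 - t) ^ 2)⁻¹ • X t a ∈ box α} with hG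
  suffices tree α ⊆ G from this ha t ht
  refine tree_subset ?_ ?_ fun i a ha => ?_
  · simp only [hG, ofPred_forall]
    refine isClosed_biInter fun t ht => ?_
    obtain ⟨K, hK⟩ := hW.lipschitz t ht.2
    have hXt : LipschitzWith (Real.toNNReal (Real.exp (K * t))) (X t) :=
      LipschitzWith.of_dist_le_mul fun a b => by
        have := ((hsol a).mono ht.2.le).dist_le hK ((hsol b).mono ht.2.le) (right_mem_Icc.2 ht.1)
        rw [(hX a).1, (hX b).1] at this
        rw [Real.coe_toNNReal _ (Real.exp_pos _).le, mul_comm]; exact this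
    exact (isClosed_box α).preimage (f := fun a => ((1 - t) ^ 2)⁻¹ • X t a)
      (hXt.continuous.const_smul (((1 - t) ^ 2)⁻¹))
  · rw [unitSegment_eq]
    rintro _ ⟨s, hs, rfl⟩ t ht
    set g : ℝ → ℝ := fun s => U !₂[s, 0] 0 with hg
    have hUg : ∀ s : ℝ, U !₂[s, 0] = !₂[g s, 0] := fun s => by
      ext j; fin_cases j
      · rfl
      · exact hseg s
    have hemb : ∀ s s' : ℝ, dist (!₂[s, 0] : Plane) !₂[s', 0] = dist s s' := fun s s' => by
      simp [EuclideanSpace.dist_eq, Fin.sum_univ_two, Real.sqrt_sq dist_nonneg]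
    have hgL : LipschitzWith L g := LipschitzWith.of_dist_le_mul fun s s' => by
      have := hL.dist_le_mul !₂[s, 0] !₂[s', 0]
      rwa [hUg, hUg, hemb, hemb] at this
    have hgM : ∀ s, ‖g s‖ ≤ M := fun s =>
      (PiLp.norm_apply_le (U !₂[s, 0]) (0 : Fin 2)).trans (hM _)
    -- As `U` vanishes at the origin, equivariance fixes the end points of the segment; these are
    -- the barriers for the one-dimensional comparison.
    have hshift : ∀ i, U (shift i) = shift i := fun i => by
      have := heq i 0 h00
      rwa [ifsMap_apply, h0, map_zero, smul_zero, add_zero] at this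
    have hg1 : g 1 = 1 := congrArg (fun x : Plane => x 0) (hshift 0)
    have hg2 : g (-1) = -1 := congrArg (fun x : Plane => x 0) (hshift 1)
    obtain ⟨ξ, hξ0, hξ⟩ := (isTamed_collapse hgL hgM).exists_isSolution s
    have hξX : IsSolution 1 (collapse U) fun t => (!₂[ξ t, 0] : Plane) := fun t ht => by
      have h1 : collapse U t !₂[ξ t, 0] =
          collapse g t (ξ t) • (!₂[1, 0] : Plane) := by
        have : ((1 - t) ^ 2)⁻¹ • (!₂[ξ t, 0] : Plane) = !₂[((1 - t) ^ 2)⁻¹ • ξ t, 0] := by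
          ext j; fin_cases j <;> simp
        rw [collapse, this, hUg, collapse]
        ext j; fin_cases j <;> simp
      have h2 : (fun t => (!₂[ξ t, 0] : Plane)) = fun t => ξ t • (!₂[1, 0] : Plane) := by
        funext t; ext j; fin_cases j <;> simp
      rw [h1, h2]
      exact (hξ t ht).smul_const _
    have hXξ : X t !₂[s, 0] = !₂[ξ t, 0] :=
      hW.eqOn (hsol _) hξX ((hX _).1.trans (by rw [hξ0])) (Ico_subset_Icc_self ht)
    have hbd := abs_le_of_isSolution_collapse hgL hgM hg1 hg2 hξ
      (by rw [hξ0]; exact abs_le.2 hs) ht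
    have hpos : 0 < (1 - t) ^ 2 := lt_of_le_of_ne (sq_nonneg _) (hlam ht).symm
    rw [hXξ]
    refine ⟨?_, ?_⟩
    · simp only [PiLp.smul_apply, smul_eq_mul, abs_mul, abs_inv, abs_of_pos hpos]
      show ((1 - t) ^ 2)⁻¹ * |ξ t| ≤ 2
      rw [inv_mul_le_iff₀ hpos]
      linarith
    · simp
      positivity
  · intro t ht
    -- The candidate for the trajectory issued from `F i a`; uniqueness identifies the two, and
    -- rescaling shows `F i` applied to a point of the box.
    have hlt : IsSolution t (collapse U) fun s => (1 - s) ^ 2 • shift i + linPart α (X s a) := by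
      intro s hs
      have hs' : s ∈ Ico (0 : ℝ) 1 := ⟨hs.1, hs.2.trans_lt ht.2⟩
      have h1 : collapse U s ((1 - s) ^ 2 • shift i + linPart α (X s a)) =
          (-2 * (1 - s)) • shift i + linPart α (collapse U s (X s a)) := by
        have h2 : ((1 - s) ^ 2)⁻¹ • ((1 - s) ^ 2 • shift i + linPart α (X s a)) =
            ifsMap α i (((1 - s) ^ 2)⁻¹ • X s a) := by
          rw [smul_add, inv_smul_smul₀ (hlam hs'), ← map_smul, ifsMap_apply, linPart_apply]
        rw [collapse, h2, heq i _ (ha s hs'), collapse, smul_add, ← linPart_apply, map_smul]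
      rw [h1]
      exact ((hasDerivAt_scale s).smul_const _).hasDerivWithinAt.add
        ((linPart α).hasFDerivAt.comp_hasDerivWithinAt s (((hsol a).mono ht.2.le) s hs))
    obtain ⟨K, hK⟩ := hW.lipschitz t ht.2
    have h3 : X t (ifsMap α i a) = (1 - t) ^ 2 • shift i + linPart α (X t a) :=
      ((hsol _).mono ht.2.le).eqOn hK hlt
        ((hX _).1.trans (by simp [(hX a).1, ifsMap_apply, linPart_apply])) (right_mem_Icc.2 ht.1)
    rw [h3, smul_add, inv_smul_smul₀ (hlam ht), ← map_smul, linPart_apply, ← ifsMap_apply]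
    exact mapsTo_ifsMap_box hα hq i (ha t ht)

theorem image_one_eq_zero {α : ℝ} (hα : 0 < α) {W X : ℝ → Plane → Plane}
    (hX : IsTrajectoryMap 1 W X)
    (hbox : ∀ t ∈ Ico (0 : ℝ) 1, ∀ a ∈ tree α, ((1 - t) ^ 2)⁻¹ • X t a ∈ box α) :
    X 1 '' tree α = {0} := by
  obtain ⟨R, hR0, hR⟩ := exists_norm_le_of_mem_box hα
  have hzero : ∀ a ∈ tree α, X 1 a = 0 := fun a ha => by
    have hsol : IsSolution 1 W fun t => X t a := (hX a).2
    have hne : (𝓝[Ico 0 1] (1 : ℝ)).NeBot := by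
      rw [← mem_closure_iff_nhdsWithin_neBot, closure_Ico zero_ne_one]; simp
    have hlim : Tendsto (fun t => X t a) (𝓝[Ico 0 1] 1) (𝓝 (X 1 a)) :=
      (hsol.continuousOn 1 (right_mem_Icc.2 zero_le_one)).mono_left
        (nhdsWithin_mono _ Ico_subset_Icc_self)
    refine tendsto_nhds_unique hlim (squeeze_zero_norm' (a := fun t => (1 - t) ^ 2 * R) ?_ ?_)
    · filter_upwards [self_mem_nhdsWithin] with t ht
      have hpos : 0 < (1 - t) ^ 2 := by
        have : 0 < 1 - t := by linarith [ht.2]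
        positivity
      have := hR _ (hbox t ht a ha)
      rwa [norm_smul, Real.norm_eq_abs, abs_of_pos (inv_pos.2 hpos), inv_mul_le_iff₀ hpos] at this
    · have hc : Continuous fun t : ℝ => (1 - t) ^ 2 * R := by fun_prop
      simpa using (hc.tendsto 1).mono_left nhdsWithin_le_nhds
  rw [eq_singleton_iff_unique_mem]
  refine ⟨⟨0, zero_mem_tree α, hzero 0 (zero_mem_tree α)⟩, ?_⟩
  rintro _ ⟨a, ha, rfl⟩
  exact hzero a ha

theorem ratio_spec {h : ℝ} (h0 : 0 < h) (h2 : h < 2) :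
    0 < (2 : ℝ) ^ (-1 / h) ∧ 2 * ((2 : ℝ) ^ (-1 / h)) ^ 2 < 1 ∧
      2 * ((2 : ℝ) ^ (-1 / h)) ^ h = 1 := by
  refine ⟨by positivity, ?_, ?_⟩
  · rw [← Real.rpow_natCast, ← Real.rpow_mul zero_le_two]
    have h3 : (2 : ℝ) ^ (-1 / h * (2 : ℕ)) < 2 ^ (-1 : ℝ) := by
      refine Real.rpow_lt_rpow_of_exponent_lt one_lt_two ?_
      push_cast
      rw [div_mul_eq_mul_div, div_lt_iff₀ h0]
      linarith
    rw [Real.rpow_neg_one] at h3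
    linarith
  · rw [← Real.rpow_mul zero_le_two, div_mul_cancel₀ _ h0.ne', Real.rpow_neg_one]
    norm_num

end FractalFlow

theorem mainTheorem5 (h : ℝ) (h_gt : 1 < h) (h_lt : h < 2) :
    ∃ (W : ℝ → FractalFlow.Plane → FractalFlow.Plane) (S : Set FractalFlow.Plane),
      UniformContinuousOn (fun p : ℝ × FractalFlow.Plane => W p.1 p.2) (Icc 0 1 ×ˢ univ) ∧
      (∀ t ∈ Icc (0 : ℝ) 1, FractalFlow.WeaklyDivFree (W t)) ∧
      IsCompact S ∧
      dimH S = ENNReal.ofReal h ∧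
      FractalFlow.IsInhomogeneousAttractor (FractalFlow.ifsMap ((2 : ℝ) ^ (-1 / h)))
        FractalFlow.unitSegment S ∧
      ∃ X : ℝ → FractalFlow.Plane → FractalFlow.Plane,
        FractalFlow.IsUniqueTrajectoryMap 1 W X ∧
        (∀ t ∈ Ico (0 : ℝ) 1, dimH (X t '' S) = ENNReal.ofReal h) ∧
        X 1 '' S = {0} := by
  have h0 : 0 < h := by linarith
  obtain ⟨hα, hq, hh⟩ := FractalFlow.ratio_spec h0 h_lt
  set α := (2 : ℝ) ^ (-1 / h)
  have hα1 : α < 1 := by nlinarith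
  obtain ⟨U, L, M, hL, hM, hU0, hdiv, heq, hzero, hseg⟩ :=
    FractalFlow.exists_selfSimilar_field hα hq
  have hW := FractalFlow.isTamed_collapse hL hM
  obtain ⟨X, hX⟩ := hW.exists_isUniqueTrajectoryMap
  have hdim : dimH (FractalFlow.tree α) = ENNReal.ofReal h :=
    le_antisymm (FractalFlow.dimH_tree_le hα hα1 h_gt.le hh)
      (FractalFlow.le_dimH_tree hα hq h0 hh)
  exact ⟨FractalFlow.collapse U, FractalFlow.tree α,
    FractalFlow.uniformContinuousOn_collapse hα hL.continuous hM hU0,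
    fun t _ => FractalFlow.weaklyDivFree_collapse hdiv t,
    FractalFlow.isCompact_tree hα hα1, hdim,
    FractalFlow.isInhomogeneousAttractor_tree hα hα1, X, hX,
    fun t ht => (hW.dimH_image hX.1 ht _).trans hdim,
    FractalFlow.image_one_eq_zero hα hX.1 fun t ht a ha =>
      FractalFlow.inv_smul_mem_box hα hq hL hM heq hzero hseg hX.1 ht ha⟩
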